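/- **Setting.** Let $\mathfrak g$ be a finite-dimensional simple complex Lie algebra of simply laced type, $\mathfrak h$ a Cartan subalgebra, $\Delta$ the root system, $\alpha_1,\dots,\alpha_s$ the simple roots of a base, $\alpha_i^\vee$ the simple coroots, $\theta=\sum_i k_i\alpha_i$ the highest root, $\mathrm{ht}(\theta)=\sum_i k_i$, and $(\cdot|\cdot)$ the invariant form on $\mathfrak g$ with $(\theta^\vee|\theta^\vee)=2$. Let $$\mathfrak T=\mathfrak g\otimes\mathbb C[t_1^{\pm1},t_2^{\pm1}]\oplus\mathbb Cc_1\oplus\mathbb Cc_2\oplus\mathbb Cd_1\oplus\mathbb Cd_2$$ be the extended double affine Lie algebra: with $x(m)=x\otimes t_1^{m_1}t_2^{m_2}$ for $m\in\mathbb Z^2$, one has $[x(m),y(n)]=[x,y](m+n)+(x|y)\,\delta_{m+n,0}\,(m_1c_1+m_2c_2)$, $[d_i,x(m)]=m_i\,x(m)$, $[d_1,d_2]=0$, and $c_1,c_2$ are central. Put $\hat{\mathfrak h}=\mathfrak h\oplus\mathbb Cc_1\oplus\mathbb Cc_2\oplus\mathbb Cd_1\oplus\mathbb Cd_2$. For $\beta\in\hat{\mathfrak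 h}^*$ let $\mathfrak T_\beta=\{x\in\mathfrak T:[h,x]=\beta(h)x\ \ \forall h\in\hat{\mathfrak h}\}$, and let $\Delta_{\mathfrak T}$ be the set of $\beta\neq0$ with $\mathfrak T_\beta\neq0$. Define $\delta_i\in\hat{\mathfrak h}^*$ by $\delta_i(\mathfrak h)=\delta_i(c_j)=0$, $\delta_i(d_j)=\delta_{ij}$. Put $\alpha_{-1}=\delta_2-\theta$, $\alpha_0=\delta_1-\theta$, $\alpha_0^\vee=c_1-\theta^\vee$, and let $\alpha_i^*\in\hat{\mathfrak h}$ $(-1\le i\le s)$ be elements with $\alpha_j(\alpha_i^*)=\delta_{ij}$ for $-1\le j\le s$. Write $\mathbb N=\{1,2,\dots\}$. Let $\varphi=\sum_{i=0}^s\alpha_i^*-\mathrm{ht}(\theta)\alpha_{-1}^*$, $\mathcal I=\{\beta\in\Delta_{\mathfrak T}:\beta(\varphi)>0\}\cup\mathbb N\delta_2$, $\Phi_+=\mathcal I\setminus\mathbb N\delta_2$, $\Phi_-=-\Phi_+$, $\Phi_0=\mathbb Z\delta_2$, and $\mathfrak T_\pm=\bigoplus_{\beta\in\Phi_\pm}\mathfrak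 T_\beta$, $\mathfrak T_0=\bigoplus_{\beta\in\Phi_0}\mathfrak T_\beta$ (the $\delta_2$-Cartan decomposition $\mathfrak T=\mathfrak T_-\oplus\mathfrak T_0\oplus\mathfrak T_+$). For $\mathcal A\subseteq\mathcal B=\{0,1,\dots,s\}$ let $f_{\mathcal A}=\sum_{i\in\mathcal B\setminus\mathcal A}\alpha_i^*-\big(\sum_{i\in\mathcal B\setminus\mathcal A,\,i\ne0}k_i\big)\alpha_{-1}^*$, $Q(\mathcal A)=\{\beta\in\Delta_{\mathfrak T}:\beta(f_{\mathcal A})\ge0\}$, $\mathfrak T_{Q(\mathcal A)}=\bigoplus_{\beta\in Q(\mathcal A)}\mathfrak T_\beta$, and $\hat{\mathfrak h}_{\mathcal A}=\mathrm{span}\{\alpha_i^\vee:i\in\mathcal A\}$. For $\lambda\in\hat{\mathfrak h}^*$ define the induced modules $$\overline M(\lambda)=U(\mathfrak T)\otimes_{U(\hat{\mathfrak h}\oplus\mathfrak T_{\mathcal I})}\mathbb C1_\lambda,\qquad M(\lambda)=U(\mathfrak T)\otimes_{U(\mathfrak T_0\oplus\mathfrak T_+)}\mathbb C1_\lambda,\qquad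 M(\lambda,\mathcal A)=U(\mathfrak T)\otimes_{U(\hat{\mathfrak h}\oplus\mathfrak T_{Q(\mathcal A)})}\mathbb C1_\lambda,$$ where in each case $\hat{\mathfrak h}$ acts on the line $\mathbb C1_\lambda$ by $\lambda$ and all root spaces $\mathfrak T_\beta$, $\beta\neq0$, of the subalgebra act by zero. The second module requires $\lambda(c_2)=0$, and the third $\lambda(\hat{\mathfrak h}_{\mathcal A}\oplus\mathbb Cc_2)=0$. Let $\overline L(\lambda)$, $L(\lambda)$, $L(\lambda,\mathcal A)$ denote their unique irreducible quotients. **Proposition.** Let $\lambda\in\hat{\mathfrak h}^*$ with $\lambda(c_2)=0$. 1. $M(\lambda)$ is a free $U(\mathfrak T_-)$-module with basis $v_\lambda=1\otimes1_\lambda$. 2. $M(\lambda)$ has a unique irreducible quotient $L(\lambda)$ (that is, exactly one maximal submodule). 3. If $\mathcal A''\subseteq\mathcal A\subseteq\mathcal B$ and $\hat{\mathfrak h}_{\mathcal A}\oplus\mathbb Cc_2\subseteq\ker\lambda$, then there are surjective $\mathfrak T$-homomorphisms $$\overline M(\lambda)\to M(\lambda)\to M(\lambda,\mathcal A'')\to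 M(\lambda,\mathcal A).$$ 4. If $\mu\in\hat{\mathfrak h}^*$ and $\mu(c_2)=0$, then every nonzero $\mathfrak T$-homomorphism $M(\lambda)\to M(\mu)$ is injective. 5. Let $\mathcal A\subseteq\mathcal B$ with $\hat{\mathfrak h}_{\mathcal A}\oplus\mathbb Cc_2\subseteq\ker\lambda$, and suppose that $\lambda(\alpha_i^\vee)\neq0$ whenever $i\in\mathcal A'\setminus\mathcal A$ for some $\mathcal A'$ with $\mathcal A\subsetneq\mathcal A'\subseteq\mathcal B$. Then $\overline M(\lambda)$ and $M(\lambda,\mathcal A)$ also have unique irreducible quotients, and $\overline L(\lambda)\cong L(\lambda)\cong L(\lambda,\mathcal A)$. -/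

import Mathlib

open scoped TensorProduct

noncomputable section

namespace DoubleAffine

/-- The ring `ℂ[t₁^±¹, t₂^±¹]` of Laurent polynomials in two commuting variables: the group algebra
of `ℤ²`, the monomial `t₁^(m 0) t₂^(m 1)` being `single m 1`. -/
abbrev Laurent : Type := AddMonoidAlgebra ℂ (Fin 2 → ℤ)

/-- The monomial `t₁^(m 0) t₂^(m 1)`. -/
def mono (m : Fin 2 → ℤ) : Laurent := AddMonoidAlgebra.single m 1

/-- The Euler derivation `tᵢ ∂/∂tᵢ` of the Laurent polynomial ring. -/
def euler (i : Fin 2) : Laurent →ₗ[ℂ] Laurent :=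
  (AddMonoidAlgebra.basis (Fin 2 → ℤ) ℂ).constr ℂ fun m ↦ (m i : ℂ) • mono m

/-- The residue pairing `(p, q) ↦ constant term of (tᵢ ∂p/∂tᵢ) q`. -/
def residue (i : Fin 2) : LinearMap.BilinForm ℂ Laurent :=
  LinearMap.mk₂ ℂ (fun p q ↦ (euler i p * q).coeff 0)
    (by intros; simp [add_mul]) (by intros; simp) (by intros; simp [mul_add]) (by intros; simp)

lemma mono_mul (m n : Fin 2 → ℤ) : mono m * mono n = mono (m + n) := by
  simp [mono, AddMonoidAlgebra.single_mul_single]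

lemma euler_mono (i : Fin 2) (m : Fin 2 → ℤ) : euler i (mono m) = (m i : ℂ) • mono m := by
  have := (AddMonoidAlgebra.basis (Fin 2 → ℤ) ℂ).constr_basis ℂ (fun m ↦ (m i : ℂ) • mono m) m
  simpa [mono, euler] using this

lemma residue_mono (i : Fin 2) (m n : Fin 2 → ℤ) :
    residue i (mono m) (mono n) = if m + n = 0 then (m i : ℂ) else 0 := by
  simp only [residue, LinearMap.mk₂_apply, euler_mono, smul_mul_assoc, mono_mul]
  simp [mono, Finsupp.single_apply]

variable {𝔤 : Type*} [LieRing 𝔤] [LieAlgebra ℂ 𝔤]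

/-- The 2-loop algebra `𝔤 ⊗ ℂ[t₁^±¹, t₂^±¹]` with the pointwise bracket. -/
def Loop (𝔤 : Type*) [LieRing 𝔤] [LieAlgebra ℂ 𝔤] : Type _ :=
  LieAlgebra.loopAlgebra ℂ (Fin 2 → ℤ) 𝔤

instance : LieRing (Loop 𝔤) :=
  inferInstanceAs (LieRing (LieAlgebra.loopAlgebra ℂ (Fin 2 → ℤ) 𝔤))

instance : LieAlgebra ℂ (Loop 𝔤) :=
  inferInstanceAs (LieAlgebra ℂ (LieAlgebra.loopAlgebra ℂ (Fin 2 → ℤ) 𝔤))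

/-- The element `x(m) = x ⊗ t₁^(m 0) t₂^(m 1)` of the 2-loop algebra, as a linear map in `x`. -/
def Loop.single (m : Fin 2 → ℤ) : 𝔤 →ₗ[ℂ] Loop 𝔤 := TensorProduct.mk ℂ Laurent 𝔤 (mono m)

lemma Loop.single_lie (m n : Fin 2 → ℤ) (x y : 𝔤) :
    ⁅Loop.single m x, Loop.single n y⁆ = Loop.single (m + n) ⁅x, y⁆ := by
  have := LieAlgebra.ExtendScalars.bracket_tmul ℂ Laurent 𝔤 𝔤 (mono m) (mono n) x y
  rw [mono_mul] at this
  exact this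

lemma Loop.induction {P : Loop 𝔤 → Prop} (h0 : P 0) (hadd : ∀ a b, P a → P b → P (a + b))
    (h : ∀ m x, P (Loop.single m x)) (a : Loop 𝔤) : P a := by
  refine TensorProduct.induction_on (motive := P) a h0 (fun p x ↦ ?_) hadd
  induction p using AddMonoidAlgebra.induction_linear with
  | zero => rw [TensorProduct.zero_tmul]; exact h0
  | add p q hp hq => rw [TensorProduct.add_tmul]; exact hadd _ _ hp hq
  | single m r =>
    have := h m (r • x)
    have e : (AddMonoidAlgebra.single m r : Laurent) = r • mono m := by simp [mono]
    rw [e, TensorProduct.smul_tmul]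
    exact this

/-- The derivation `tᵢ ∂/∂tᵢ` of the 2-loop algebra. -/
def loopEuler (i : Fin 2) : Loop 𝔤 →ₗ[ℂ] Loop 𝔤 := (euler i).rTensor 𝔤

lemma loopEuler_single (i : Fin 2) (m : Fin 2 → ℤ) (x : 𝔤) :
    loopEuler i (Loop.single m x) = (m i : ℂ) • Loop.single m x := by
  have : (euler i).rTensor 𝔤 (mono m ⊗ₜ[ℂ] x) = (m i : ℂ) • (mono m ⊗ₜ[ℂ] x) := by
    simp [euler_mono, TensorProduct.smul_tmul']
  exact this

/-- A symmetric invariant bilinear form on a Lie algebra. -/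
structure InvariantForm (𝔤 : Type*) [LieRing 𝔤] [LieAlgebra ℂ 𝔤] where
  form : LinearMap.BilinForm ℂ 𝔤
  symm : ∀ x y, form x y = form y x
  invariant : ∀ x y z, form ⁅x, y⁆ z = form x ⁅y, z⁆

/-- The two cocycles of the 2-loop algebra:
`(x(m), y(n)) ↦ (x|y) δ_{m+n,0} mᵢ`, where `x(m) = x ⊗ t₁^(m 0) t₂^(m 1)`. -/
def cocycle (Φ : InvariantForm 𝔤) (i : Fin 2) : LinearMap.BilinForm ℂ (Loop 𝔤) :=
  LinearMap.BilinForm.tmul (residue i) Φ.form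

lemma cocycle_single (Φ : InvariantForm 𝔤) (i : Fin 2) (m n : Fin 2 → ℤ) (x y : 𝔤) :
    cocycle Φ i (Loop.single m x) (Loop.single n y) =
      if m + n = 0 then (m i : ℂ) * Φ.form x y else 0 := by
  have : LinearMap.BilinForm.tmul (residue i) Φ.form (mono m ⊗ₜ[ℂ] x) (mono n ⊗ₜ[ℂ] y) =
      if m + n = 0 then (m i : ℂ) * Φ.form x y else 0 := by
    simp only [LinearMap.BilinForm.tensorDistrib_tmul, residue_mono]
    split_ifs <;> simp [mul_comm]
  exact this

lemma cocycle_swap (Φ : InvariantForm 𝔤) (i : Fin 2) (a b : Loop 𝔤) :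
    cocycle Φ i a b = -cocycle Φ i b a := by
  induction a using Loop.induction with
  | h0 => simp
  | hadd a a' h h' => simp only [map_add, LinearMap.add_apply, h, h']; ring
  | h m x =>
    induction b using Loop.induction with
    | h0 => simp
    | hadd a a' h h' => simp only [map_add, LinearMap.add_apply, h, h']; ring
    | h n y =>
      simp only [cocycle_single, add_comm n m, Φ.symm y x]
      split_ifs with hmn
      · rw [eq_neg_of_add_eq_zero_left hmn]; simp
      · simp

lemma cocycle_lie (Φ : InvariantForm 𝔤) (i : Fin 2) (a b c : Loop 𝔤) :
    cocycle Φ i a ⁅b, c⁆ = cocycle Φ i ⁅a, b⁆ c + cocycle Φ i b ⁅a, c⁆ := by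
  induction a using Loop.induction with
  | h0 => simp
  | hadd a a' h h' => simp only [map_add, LinearMap.add_apply, add_lie, h, h']; ring
  | h m x =>
    induction b using Loop.induction with
    | h0 => simp
    | hadd a a' h h' => simp only [map_add, LinearMap.add_apply, add_lie, lie_add, h, h']; ring
    | h n y =>
      induction c using Loop.induction with
      | h0 => simp
      | hadd a a' h h' => simp only [map_add, lie_add, h, h']; ring
      | h p z =>
        simp only [Loop.single_lie, cocycle_single]
        have e1 : m + n + p = m + (n + p) := by abel
        have e2 : n + (m + p) = m + (n + p) := by abel
        rw [e1, e2]
        split_ifs with h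
        · have h1 : Φ.form y ⁅x, z⁆ = -Φ.form x ⁅y, z⁆ := by
            rw [← Φ.invariant, ← lie_skew, map_neg, LinearMap.neg_apply, Φ.invariant]
          rw [h1, Φ.invariant]
          simp only [Pi.add_apply, Int.cast_add]; ring
        · simp

lemma cocycle_loopEuler (Φ : InvariantForm 𝔤) (i j : Fin 2) (a b : Loop 𝔤) :
    cocycle Φ i (loopEuler j a) b = -cocycle Φ i a (loopEuler j b) := by
  induction a using Loop.induction with
  | h0 => simp
  | hadd a a' h h' => simp only [map_add, LinearMap.add_apply, h, h']; ring
  | h m x =>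
    induction b using Loop.induction with
    | h0 => simp
    | hadd a a' h h' => simp only [map_add, h, h']; ring
    | h n y =>
      simp only [loopEuler_single, map_smul, LinearMap.smul_apply, cocycle_single]
      split_ifs with hmn
      · rw [eq_neg_of_add_eq_zero_left hmn]; simp
      · simp

lemma loopEuler_lie (j : Fin 2) (a b : Loop 𝔤) :
    loopEuler j ⁅a, b⁆ = ⁅loopEuler j a, b⁆ + ⁅a, loopEuler j b⁆ := by
  induction a using Loop.induction with
  | h0 => simp
  | hadd a a' h h' => simp only [map_add, add_lie, h, h']; abel
  | h m x =>
    induction b using Loop.induction with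
    | h0 => simp
    | hadd a a' h h' => simp only [map_add, lie_add, h, h']; abel
    | h n y =>
      simp only [loopEuler_single, smul_lie, lie_smul, Loop.single_lie, Pi.add_apply, Int.cast_add, add_smul]

lemma loopEuler_comm (i j : Fin 2) (a : Loop 𝔤) :
    loopEuler i (loopEuler j a) = loopEuler j (loopEuler i a) := by
  induction a using Loop.induction with
  | h0 => simp
  | hadd a a' h h' => simp only [map_add, h, h']
  | h m x => simp only [loopEuler_single, map_smul]; rw [smul_comm]

/-- The derivation `d₁ t₁ ∂/∂t₁ + d₂ t₂ ∂/∂t₂` of the 2-loop algebra. -/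
def eulerSum (d : Fin 2 → ℂ) : Loop 𝔤 →ₗ[ℂ] Loop 𝔤 := ∑ i, d i • loopEuler i

lemma eulerSum_apply (d : Fin 2 → ℂ) (a : Loop 𝔤) :
    eulerSum d a = d 0 • loopEuler 0 a + d 1 • loopEuler 1 a := by
  simp [eulerSum, Fin.sum_univ_two]

end DoubleAffine

/-- The extended double affine Lie algebra
`𝔗 = 𝔤 ⊗ ℂ[t₁^±¹, t₂^±¹] ⊕ ℂc₁ ⊕ ℂc₂ ⊕ ℂd₁ ⊕ ℂd₂`. The components `c` and `d` are the
coefficients of `c₁, c₂` and of `d₁, d₂`. -/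
@[ext] structure DoubleAffine {𝔤 : Type*} [LieRing 𝔤] [LieAlgebra ℂ 𝔤]
    (Φ : DoubleAffine.InvariantForm 𝔤) where
  loop : DoubleAffine.Loop 𝔤
  c : Fin 2 → ℂ
  d : Fin 2 → ℂ

namespace DoubleAffine

variable {𝔤 : Type*} [LieRing 𝔤] [LieAlgebra ℂ 𝔤] (Φ : InvariantForm 𝔤)

/-- `𝔗` as a vector space. -/
def toProd : DoubleAffine Φ ≃ Loop 𝔤 × (Fin 2 → ℂ) × (Fin 2 → ℂ) where
  toFun x := (x.loop, x.c, x.d)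
  invFun x := ⟨x.1, x.2.1, x.2.2⟩
  left_inv _ := rfl
  right_inv _ := rfl

instance : AddCommGroup (DoubleAffine Φ) := (toProd Φ).addCommGroup

instance : Module ℂ (DoubleAffine Φ) := (toProd Φ).module ℂ

variable {Φ}

@[simp] lemma loop_zero : (0 : DoubleAffine Φ).loop = 0 := rfl
@[simp] lemma c_zero : (0 : DoubleAffine Φ).c = 0 := rfl
@[simp] lemma d_zero : (0 : DoubleAffine Φ).d = 0 := rfl
@[simp] lemma loop_add (x y : DoubleAffine Φ) : (x + y).loop = x.loop + y.loop := rfl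
@[simp] lemma c_add (x y : DoubleAffine Φ) : (x + y).c = x.c + y.c := rfl
@[simp] lemma d_add (x y : DoubleAffine Φ) : (x + y).d = x.d + y.d := rfl
@[simp] lemma loop_smul (r : ℂ) (x : DoubleAffine Φ) : (r • x).loop = r • x.loop := rfl
@[simp] lemma c_smul (r : ℂ) (x : DoubleAffine Φ) : (r • x).c = r • x.c := rfl
@[simp] lemma d_smul (r : ℂ) (x : DoubleAffine Φ) : (r • x).d = r • x.d := rfl

/-- `[x(m), y(n)] = [x,y](m+n) + (x|y) δ_{m+n,0} (m₁c₁ + m₂c₂)`, `[dᵢ, x(m)] = mᵢ x(m)`,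
the `cᵢ` are central and `[d₁, d₂] = 0`. -/
instance : Bracket (DoubleAffine Φ) (DoubleAffine Φ) where
  bracket x y :=
    { loop := ⁅x.loop, y.loop⁆ + eulerSum x.d y.loop - eulerSum y.d x.loop
      c := fun i ↦ cocycle Φ i x.loop y.loop
      d := 0 }

@[simp] lemma loop_lie (x y : DoubleAffine Φ) :
    ⁅x, y⁆.loop = ⁅x.loop, y.loop⁆ + eulerSum x.d y.loop - eulerSum y.d x.loop := rfl
@[simp] lemma c_lie (x y : DoubleAffine Φ) :
    ⁅x, y⁆.c = fun i ↦ cocycle Φ i x.loop y.loop := rfl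
@[simp] lemma d_lie (x y : DoubleAffine Φ) : ⁅x, y⁆.d = 0 := rfl

instance : LieRing (DoubleAffine Φ) where
  add_lie x y z := by
    ext1
    · simp only [loop_lie, loop_add, d_add, add_lie, eulerSum_apply, map_add,
        Pi.add_apply, add_smul]; abel
    · ext i; simp
    · simp
  lie_add x y z := by
    ext1
    · simp only [loop_lie, loop_add, d_add, lie_add, eulerSum_apply, map_add,
        Pi.add_apply, add_smul]; abel
    · ext i; simp
    · simp
  lie_self x := by
    ext1
    · simp
    · ext i
      have := cocycle_swap Φ i x.loop x.loop
      simpa using self_eq_neg.mp this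
    · simp
  leibniz_lie x y z := by
    ext1
    · have e := leibniz_lie x.loop y.loop z.loop
      have e0 := lie_skew y.loop (loopEuler 0 x.loop)
      have e1 := lie_skew y.loop (loopEuler 1 x.loop)
      simp only [loop_lie, d_lie, loop_add, e, eulerSum_apply, map_add, map_sub, map_smul,
        lie_add, add_lie, lie_sub, sub_lie, lie_smul, smul_lie, loopEuler_lie, smul_add,
        Pi.zero_apply, zero_smul, loopEuler_comm 1 0, ← e0, ← e1]
      module
    · ext i
      have e (j : Fin 2) : cocycle Φ i y.loop (loopEuler j x.loop) =
          cocycle Φ i x.loop (loopEuler j y.loop) := by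
        rw [cocycle_swap, cocycle_loopEuler, neg_neg]
      simp only [c_lie, c_add, loop_lie, Pi.add_apply, eulerSum_apply, map_add, map_sub, map_smul,
        LinearMap.add_apply, LinearMap.sub_apply, LinearMap.smul_apply, cocycle_lie Φ i x.loop,
        cocycle_loopEuler, smul_eq_mul, e]
      ring
    · simp

instance : LieAlgebra ℂ (DoubleAffine Φ) where
  lie_smul r x y := by
    ext1
    · simp only [loop_lie, loop_smul, d_smul, lie_smul, eulerSum_apply, map_smul, Pi.smul_apply,
        smul_eq_mul]; module
    · ext i; simp
    · simp

/-- The coefficient of `t₁^(m 0) t₂^(m 1)` in an element of the 2-loop algebra. -/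
def Loop.coeff (m : Fin 2 → ℤ) : Loop 𝔤 →ₗ[ℂ] 𝔤 :=
  Finsupp.lapply m ∘ₗ (LieAlgebra.LoopAlgebra.toFinsupp ℂ (Fin 2 → ℤ) 𝔤).toLinearMap

lemma Loop.coeff_single (m n : Fin 2 → ℤ) (x : 𝔤) :
    Loop.coeff m (Loop.single n x) = if n = m then x else 0 := by
  have : LieAlgebra.LoopAlgebra.toFinsupp ℂ (Fin 2 → ℤ) 𝔤 (mono n ⊗ₜ[ℂ] x) = Finsupp.single n x :=
    LieAlgebra.LoopAlgebra.toFinsupp_single_tmul _ _ _ _ _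
  change (LieAlgebra.LoopAlgebra.toFinsupp ℂ (Fin 2 → ℤ) 𝔤 (mono n ⊗ₜ[ℂ] x)) m = _
  rw [this, Finsupp.single_apply]

lemma Loop.exists_coeff_ne {a : Loop 𝔤} (ha : a ≠ 0) : ∃ m, Loop.coeff m a ≠ 0 := by
  by_contra! h
  exact ha ((LieAlgebra.LoopAlgebra.toFinsupp ℂ (Fin 2 → ℤ) 𝔤).map_eq_zero_iff.mp (Finsupp.ext h))

lemma Loop.coeff_lie (m : Fin 2 → ℤ) (x : 𝔤) (a : Loop 𝔤) :
    Loop.coeff m ⁅Loop.single 0 x, a⁆ = ⁅x, Loop.coeff m a⁆ := by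
  induction a using Loop.induction with
  | h0 => simp
  | hadd a a' h h' => simp only [map_add, lie_add, h, h']
  | h n y =>
    rw [Loop.single_lie, Loop.coeff_single, Loop.coeff_single, zero_add]
    split_ifs <;> simp

lemma Loop.coeff_eulerSum (m : Fin 2 → ℤ) (d : Fin 2 → ℂ) (a : Loop 𝔤) :
    Loop.coeff m (eulerSum d a) = (d 0 * m 0 + d 1 * m 1) • Loop.coeff m a := by
  induction a using Loop.induction with
  | h0 => simp
  | hadd a a' h h' => simp only [map_add, h, h', smul_add]
  | h n y =>
    simp only [eulerSum_apply, map_add, map_smul, loopEuler_single, Loop.coeff_single]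
    split_ifs with e
    · subst e; module
    · simp

lemma cocycle_single_zero (Φ : InvariantForm 𝔤) (i : Fin 2) (x : 𝔤) (a : Loop 𝔤) :
    cocycle Φ i (Loop.single 0 x) a = 0 := by
  induction a using Loop.induction with
  | h0 => simp
  | hadd a a' h h' => simp only [map_add, h, h', add_zero]
  | h n y => simp [cocycle_single]

lemma eulerSum_single_zero (d : Fin 2 → ℂ) (x : 𝔤) : eulerSum d (Loop.single 0 x) = 0 := by
  simp [eulerSum_apply, loopEuler_single]

end DoubleAffine

namespace DoubleAffine

section Roots

open LieAlgebra LieAlgebra.IsKilling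

variable {𝔤 : Type*} [LieRing 𝔤] [LieAlgebra ℂ 𝔤] [Module.Finite ℂ 𝔤] [LieAlgebra.IsSimple ℂ 𝔤]
variable {H : LieSubalgebra ℂ 𝔤} [H.IsCartanSubalgebra]
variable (b : (rootSystem H).Base)

/-- There is a root of maximal height. -/
lemma exists_highest : ∃ θ : H.root, ∀ α, b.height α ≤ b.height θ := by
  have : Nonempty H.root := by
    by_contra hne
    rw [not_nonempty_iff] at hne
    have h1 : Nontrivial (Module.Dual ℂ H) :=
      (inferInstance : (rootSystem H).IsIrreducible).nontrivial
    have h2 := (inferInstance : (rootSystem H).IsRootSystem).span_root_eq_top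
    rw [Set.range_eq_empty, Submodule.span_empty] at h2
    exact bot_ne_top h2
  exact Finite.exists_max b.height

/-- The highest root `θ` of `𝔤`. -/
def highestRoot : H.root := (exists_highest b).choose

/-- The coefficients in `θ = ∑ kᵢ αᵢ`. -/
def mark (i : b.support) : ℂ :=
  b.toWeightBasis.repr ((rootSystem H).root (highestRoot b)) i

/-- The invariant form on `𝔤`: the multiple of the Killing form with `(θ^∨|θ^∨) = 2`. -/
def normalizedForm : InvariantForm 𝔤 where
  form :=
    (2 / killingForm ℂ 𝔤 ((rootSystem H).coroot (highestRoot b))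
      ((rootSystem H).coroot (highestRoot b))) • killingForm ℂ 𝔤
  symm x y := by
    simp only [LinearMap.smul_apply]
    rw [LieModule.traceForm_comm ℂ 𝔤 𝔤 x y]
  invariant x y z := by
    simp only [LinearMap.smul_apply]
    rw [LieModule.traceForm_apply_lie_apply]

/-- The extended double affine Lie algebra `𝔗` of `𝔤`. -/
abbrev 𝔗 : Type _ := DoubleAffine (normalizedForm b)

/-- The Cartan subalgebra `𝔥̂ = 𝔥 ⊕ ℂc₁ ⊕ ℂc₂ ⊕ ℂd₁ ⊕ ℂd₂`; a triple `(h, c, d)` consists of an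
element of `𝔥` and of the coefficients of `c₁, c₂` and of `d₁, d₂`. -/
abbrev Cartan (H : LieSubalgebra ℂ 𝔤) : Type _ := H × (Fin 2 → ℂ) × (Fin 2 → ℂ)

/-- The inclusion of `𝔥̂` in `𝔗`. -/
def cartanIncl : Cartan H →ₗ[ℂ] 𝔗 b where
  toFun h := { loop := Loop.single 0 (h.1 : 𝔤), c := h.2.1, d := h.2.2 }
  map_add' x y := by ext1 <;> simp
  map_smul' r x := by ext1 <;> simp

/-- The weight space `𝔗_β = {x | [h, x] = β(h) x for all h ∈ 𝔥̂}`. -/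
def rootSpace (β : Module.Dual ℂ (Cartan H)) : Submodule ℂ (𝔗 b) where
  carrier := {x | ∀ h, ⁅cartanIncl b h, x⁆ = β h • x}
  zero_mem' h := by simp
  add_mem' hx hy h := by rw [lie_add, hx h, hy h, smul_add]
  smul_mem' r x hx h := by rw [lie_smul, hx h, smul_comm]

/-- The root system `Δ_𝔗`. -/
def roots : Set (Module.Dual ℂ (Cartan H)) := {β | β ≠ 0 ∧ rootSpace b β ≠ ⊥}

/-- The imaginary root `δ₁` (for `j = 0`) or `δ₂` (for `j = 1`): it vanishes on `𝔥`, `c₁`, `c₂` and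
takes the value `δᵢⱼ` on `dᵢ`. -/
def delta (j : Fin 2) : Module.Dual ℂ (Cartan H) :=
  LinearMap.proj j ∘ₗ LinearMap.snd ℂ _ _ ∘ₗ LinearMap.snd ℂ _ _

/-- The index set `{0, 1, …, s}` of the simple roots of the first affine subalgebra: `none` is `0`
and `some i` are the indices of the simple roots of `𝔤`. -/
abbrev Index : Type _ := Option b.support

/-- The coroot `αᵢ^∨`, where `α₀^∨ = c₁ - θ^∨`. -/
def simpleCoroot : Index b → Cartan H
  | none => (-(rootSystem H).coroot (highestRoot b), Pi.single 0 1, 0)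
  | some i => ((rootSystem H).coroot i, 0, 0)

/-- The central element `c₁` (for `j = 0`) or `c₂` (for `j = 1`). -/
def central (H : LieSubalgebra ℂ 𝔤) (j : Fin 2) : Cartan H := (0, Pi.single j 1, 0)

/-- The fundamental coweight of `𝔤`: the element of `𝔥` dual to the simple root `αᵢ`. -/
def coweight (i : b.support) : H := (Module.evalEquiv ℂ H).symm (b.toWeightBasis.coord i)

/-- The element `αᵢ^*` of `𝔥̂` for `i = 0, …, s`, dual to the simple roots `α₋₁ = δ₂ - θ`,
`α₀ = δ₁ - θ`, `α₁, …, αₛ` of `𝔗`. -/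
def dualSimple : Index b → Cartan H
  | none => (0, 0, Pi.single 0 1)
  | some i => (coweight b i, 0, fun _ ↦ mark b i)

/-- The element `α₋₁^* = d₂` of `𝔥̂`. -/
def dualSimpleNegOne (H : LieSubalgebra ℂ 𝔤) : Cartan H := (0, 0, Pi.single 1 1)

/-- `φ = ∑_{i=0}^s αᵢ^* - ht(θ) α₋₁^*`, where `ht(θ) = ∑ kᵢ`. -/
def phi : Cartan H := ∑ i, dualSimple b i - (∑ i, mark b i) • dualSimpleNegOne H

/-- The closed subset `ℐ = {β ∈ Δ_𝔗 | φ(β) > 0} ∪ ℕδ₂`; the numbers `φ(β)`, `β ∈ Δ_𝔗`, are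
integers, and `ℕ` starts at `1`. -/
def setI : Set (Module.Dual ℂ (Cartan H)) :=
  {β ∈ roots b | 0 < (β (phi b)).re} ∪ {β | ∃ n : ℕ, 0 < n ∧ β = n • delta 1}

/-- `Φ₊ = ℐ ∖ ℕδ₂`. -/
def phiPos : Set (Module.Dual ℂ (Cartan H)) :=
  setI b \ {β | ∃ n : ℕ, 0 < n ∧ β = n • delta 1}

/-- `Φ₋ = -Φ₊`. -/
def phiNeg : Set (Module.Dual ℂ (Cartan H)) := {β | -β ∈ phiPos b}

/-- `Φ₀ = ℤδ₂`. -/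
def phiZero (H : LieSubalgebra ℂ 𝔤) : Set (Module.Dual ℂ (Cartan H)) :=
  {β | ∃ n : ℤ, β = n • delta 1}

open scoped Classical in
/-- `f_𝒜 = ∑_{i ∈ ℬ∖𝒜} αᵢ^* - (∑_{i ∈ ℬ^*∖𝒜^*} kᵢ) α₋₁^*`; it is zero for `𝒜 = ℬ`. -/
def fA (A : Finset (Index b)) : Cartan H :=
  ∑ i with i ∉ A, dualSimple b i - (∑ i : b.support with some i ∉ A, mark b i) • dualSimpleNegOne H

/-- `Q(𝒜) = {β ∈ Δ_𝔗 | f_𝒜(β) ≥ 0}`; the numbers `f_𝒜(β)`, `β ∈ Δ_𝔗`, are integers. -/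
def setQ (A : Finset (Index b)) : Set (Module.Dual ℂ (Cartan H)) :=
  {β ∈ roots b | 0 ≤ (β (fA b A)).re}

/-- `𝔥̂_𝒜 ⊕ ℂc₂`, where `𝔥̂_𝒜` is spanned by the `αᵢ^∨`, `i ∈ 𝒜`. -/
def cartanA (A : Finset (Index b)) : Submodule ℂ (Cartan H) :=
  Submodule.span ℂ (simpleCoroot b '' A) ⊔ Submodule.span ℂ {central H 1}

variable {b}

lemma lie_mem_rootSpace {α β : Module.Dual ℂ (Cartan H)} {x y : 𝔗 b} (hx : x ∈ rootSpace b α)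
    (hy : y ∈ rootSpace b β) : ⁅x, y⁆ ∈ rootSpace b (α + β) := by
  intro h
  rw [leibniz_lie, hx h, hy h, smul_lie, lie_smul, ← add_smul, LinearMap.add_apply]

/-- Criterion for `y(m)` to be a root vector. -/
lemma single_mem_rootSpace {β : Module.Dual ℂ (Cartan H)} (m : Fin 2 → ℤ) (y : 𝔤)
    (h : ∀ h : Cartan H, ⁅(h.1 : 𝔤), y⁆ + (h.2.2 0 * m 0 + h.2.2 1 * m 1) • y = β h • y) :
    ({ loop := Loop.single m y, c := 0, d := 0 } : 𝔗 b) ∈ rootSpace b β := by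
  intro k
  ext1
  · have := congrArg (Loop.single m) (h k)
    rw [map_add, map_smul, map_smul] at this
    simp only [cartanIncl, LinearMap.coe_mk, AddHom.coe_mk, loop_lie, Loop.single_lie, zero_add,
      eulerSum_apply, loopEuler_single, Pi.zero_apply, zero_smul, add_zero, sub_zero, loop_smul]
    rw [← this]
    module
  · ext i; simp [cartanIncl, cocycle_single_zero]
  · simp

/-- A root vector has a nonzero coefficient, which is a simultaneous eigenvector for `𝔥`. -/
lemma exists_of_mem_roots {β : Module.Dual ℂ (Cartan H)} (hβ : β ∈ roots b) :
    ∃ (m : Fin 2 → ℤ) (y : 𝔤), y ≠ 0 ∧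
      ∀ h : Cartan H, ⁅(h.1 : 𝔤), y⁆ + (h.2.2 0 * m 0 + h.2.2 1 * m 1) • y = β h • y := by
  obtain ⟨h0, hne⟩ := hβ
  obtain ⟨x, hx, hx0⟩ := Submodule.exists_mem_ne_zero_of_ne_bot hne
  obtain ⟨k, hk⟩ : ∃ k, β k ≠ 0 := by
    by_contra! h
    exact h0 (LinearMap.ext h)
  have hd : x.d = 0 := by
    have := congrArg DoubleAffine.d (hx k)
    simpa [hk] using this.symm
  have hc : x.c = 0 := by
    have := congrArg DoubleAffine.c (hx k)
    have h2 : (0 : Fin 2 → ℂ) = β k • x.c := by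
      rw [← c_smul, ← this]
      ext i
      simp [cartanIncl, cocycle_single_zero]
    simpa [hk] using h2.symm
  have hl : x.loop ≠ 0 := fun hl ↦ hx0 (DoubleAffine.ext hl hc hd)
  obtain ⟨m, hm⟩ := Loop.exists_coeff_ne hl
  refine ⟨m, Loop.coeff m x.loop, hm, fun h ↦ ?_⟩
  have := congrArg (fun z : 𝔗 b ↦ Loop.coeff m z.loop) (hx h)
  simpa [cartanIncl, eulerSum_single_zero, Loop.coeff_lie, Loop.coeff_eulerSum] using this

lemma neg_mem_roots {β : Module.Dual ℂ (Cartan H)} (hβ : β ∈ roots b) : -β ∈ roots b := by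
  obtain ⟨m, y, hy, h⟩ := exists_of_mem_roots hβ
  refine ⟨neg_ne_zero.mpr hβ.1, ?_⟩
  let χ : H → ℂ := fun k ↦ β (k, 0, 0)
  have hχ (k : H) : ⁅(k : 𝔤), y⁆ = χ k • y := by simpa using h (k, 0, 0)
  obtain ⟨z, hz, hzχ⟩ : ∃ z : 𝔤, z ≠ 0 ∧ ∀ k : H, ⁅(k : 𝔤), z⁆ = -χ k • z := by
    have hmem : y ∈ LieAlgebra.rootSpace H χ :=
      LieModule.weightSpace_le_genWeightSpace 𝔤 χ <| by
        rw [LieModule.mem_weightSpace]; exact hχ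
    have hne : LieAlgebra.rootSpace H χ ≠ ⊥ := fun e ↦ hy (by rw [e] at hmem; simpa using hmem)
    let w : LieModule.Weight ℂ H 𝔤 := ⟨χ, hne⟩
    obtain ⟨z, hz, hz0⟩ := (LieSubmodule.eq_bot_iff _).not.mp
      (-w).genWeightSpace_ne_bot |> fun h ↦ by push Not at h; exact h
    refine ⟨z, hz0, fun k ↦ ?_⟩
    have := lie_eq_smul_of_mem_rootSpace hz k
    simpa [w] using! this
  have hmem := single_mem_rootSpace (b := b) (β := -β) (-m) z fun k ↦ by
    have e1 : β k • y = (χ k.1 + (k.2.2 0 * m 0 + k.2.2 1 * m 1)) • y := by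
      rw [← h k, hχ]; module
    rw [smul_left_injective ℂ hy e1 |> fun e : β k = _ ↦ (LinearMap.neg_apply β k).trans
      (congrArg Neg.neg e), hzχ]
    simp only [Pi.neg_apply, Int.cast_neg]
    module
  intro e
  rw [e, Submodule.mem_bot] at hmem
  have := congrArg (fun z : 𝔗 b ↦ Loop.coeff (-m) z.loop) hmem
  exact hz (by simpa [Loop.coeff_single] using this)

variable (b)

/-- `δ₂(φ) = 0`. -/
lemma delta_phi : delta 1 (phi b) = 0 := by
  simp [phi, delta, Fintype.sum_option, dualSimple, dualSimpleNegOne, Prod.snd_sum]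

lemma phi_pos_of_mem {β : Module.Dual ℂ (Cartan H)} (hβ : β ∈ phiPos b) :
    β ∈ roots b ∧ 0 < (β (phi b)).re := by
  rcases hβ with ⟨h | h, h'⟩
  · exact h
  · exact absurd h h'

/-- `𝔗₋`, the sum of the root spaces `𝔗_β` with `β ∈ Φ₋`. -/
def tNeg : LieSubalgebra ℂ (𝔗 b) where
  toSubmodule := ⨆ β ∈ phiNeg b, rootSpace b β
  lie_mem' := by
    intro x y hx hy
    change x ∈ ⨆ β ∈ phiNeg b, rootSpace b β at hx
    change y ∈ ⨆ β ∈ phiNeg b, rootSpace b β at hy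
    change ⁅x, y⁆ ∈ ⨆ β ∈ phiNeg b, rootSpace b β
    rw [iSup_subtype'] at hx hy
    induction hx using Submodule.iSup_induction' with
    | zero => simp
    | add u v _ _ hu hv => rw [add_lie]; exact add_mem hu hv
    | mem α u hu =>
      induction hy using Submodule.iSup_induction' with
      | zero => simp
      | add v w _ _ hv hw => rw [lie_add]; exact add_mem hv hw
      | mem β v hv =>
        by_cases hz : ⁅u, v⁆ = 0
        · rw [hz]; exact zero_mem _
        have hm := lie_mem_rootSpace hu hv
        refine Submodule.mem_iSup_of_mem _ (Submodule.mem_iSup_of_mem ?_ hm)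
        obtain ⟨-, hα⟩ := phi_pos_of_mem b α.2
        obtain ⟨-, hβ⟩ := phi_pos_of_mem b β.2
        have hpos : 0 < ((-(α.1 + β.1)) (phi b)).re := by
          simp only [LinearMap.neg_apply, LinearMap.add_apply, Complex.neg_re,
            Complex.add_re] at hα hβ ⊢
          linarith
        have hroot : -(α.1 + β.1) ∈ roots b := by
          refine neg_mem_roots ⟨fun e ↦ ?_, fun e ↦ hz ?_⟩
          · rw [e] at hpos; simp at hpos
          · rw [e] at hm; simpa using hm
        refine ⟨Or.inl ⟨hroot, hpos⟩, ?_⟩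
        rintro ⟨n, -, e⟩
        rw [e, LinearMap.smul_apply, delta_phi] at hpos
        simp at hpos

end Roots

section Modules

open LieAlgebra LieAlgebra.IsKilling

attribute [local instance 100] LieRing.ofAssociativeRing

variable {𝔤 : Type*} [LieRing 𝔤] [LieAlgebra ℂ 𝔤] [Module.Finite ℂ 𝔤] [LieAlgebra.IsSimple ℂ 𝔤]
variable {H : LieSubalgebra ℂ 𝔤} [H.IsCartanSubalgebra]
variable (b : (rootSystem H).Base)

/-- The universal enveloping algebra `U(𝔗)`. A `𝔗`-module is a module over it. -/
abbrev U𝔗 : Type _ := UniversalEnvelopingAlgebra ℂ (𝔗 b)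

/-- The left ideal of `U(𝔗)` generated by the root spaces `𝔗_β`, `β ∈ S`, and by the elements
`h - λ(h)`, `h ∈ 𝔥̂`. -/
def inducingIdeal (S : Set (Module.Dual ℂ (Cartan H))) (lam : Module.Dual ℂ (Cartan H)) :
    Submodule (U𝔗 b) (U𝔗 b) :=
  Submodule.span (U𝔗 b)
    ({u | ∃ β ∈ S, ∃ x ∈ rootSpace b β, u = UniversalEnvelopingAlgebra.ι ℂ x} ∪
      {u | ∃ h : Cartan H, u = UniversalEnvelopingAlgebra.ι ℂ (cartanIncl b h) -
        algebraMap ℂ (U𝔗 b) (lam h)})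

/-- The induced module `U(𝔗) ⊗_{U(𝔭)} ℂ1_λ`, where `𝔭 = 𝔥̂ ⊕ ⨁_{β ∈ S} 𝔗_β` and `ℂ1_λ` is the
one-dimensional `𝔭`-module on which `𝔥̂` acts by `λ` and every `𝔗_β`, `β ∈ S`, acts by zero. It is
presented as the quotient of `U(𝔗)` by the left ideal which the annihilator of `1_λ` generates. -/
abbrev Induced (S : Set (Module.Dual ℂ (Cartan H))) (lam : Module.Dual ℂ (Cartan H)) : Type _ :=
  U𝔗 b ⧸ inducingIdeal b S lam

/-- The imaginary Verma module, induced from `𝔥̂ ⊕ 𝔗_ℐ`. -/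
abbrev ImaginaryVerma (lam : Module.Dual ℂ (Cartan H)) : Type _ := Induced b (setI b) lam

/-- The generalized imaginary Verma module `M(λ, 𝒜)`, induced from `𝔥̂ ⊕ 𝔗_{Q(𝒜)}`. -/
abbrev GeneralizedVerma (A : Finset (Index b)) (lam : Module.Dual ℂ (Cartan H)) : Type _ :=
  Induced b (setQ b A) lam

/-- The highest weight module `M(λ)`, induced from `𝔗₀ ⊕ 𝔗₊`; here `𝔗₀ = ⨁_{β ∈ Φ₀} 𝔗_β` is
`𝔥̂` plus the root spaces of the nonzero elements of `Φ₀`, and `λ` is extended by zero to the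
latter. -/
abbrev Verma (lam : Module.Dual ℂ (Cartan H)) : Type _ :=
  Induced b (phiPos b ∪ (phiZero H \ {0})) lam

/-- The generator `v_λ = 1 ⊗ 1_λ` of `M(λ)`. -/
def Verma.gen (lam : Module.Dual ℂ (Cartan H)) : Verma b lam := Submodule.Quotient.mk 1

/-- The map `U(𝔗₋) → U(𝔗)` induced by the inclusion of `𝔗₋`. -/
def tNegMap : UniversalEnvelopingAlgebra ℂ (tNeg b) →ₐ[ℂ] U𝔗 b :=
  UniversalEnvelopingAlgebra.lift ℂ ((UniversalEnvelopingAlgebra.ι ℂ).comp (tNeg b).incl)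

/-- The sum of all proper submodules of a module. -/
def radical (R : Type*) [Ring R] (M : Type*) [AddCommGroup M] [Module R M] : Submodule R M :=
  sSup {N | N ≠ ⊤}

/-- The module has exactly one maximal submodule, equivalently exactly one irreducible quotient,
and it is the quotient by the sum of all proper submodules. -/
def HasUniqueIrreducibleQuotient (R : Type*) [Ring R] (M : Type*) [AddCommGroup M] [Module R M] :
    Prop :=
  IsCoatom (radical R M) ∧ ∀ N : Submodule R M, IsCoatom N → N = radical R M

/-- The irreducible quotient of a module that has only one. -/
abbrev IrreducibleQuotient (R : Type*) [Ring R] (M : Type*) [AddCommGroup M] [Module R M] :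
    Type _ :=
  M ⧸ radical R M

end Modules

end DoubleAffine

end

/-! Every module here is `U(𝔗)` modulo a left ideal `inducingIdeal b S lam`, which grows with `S`.
The surjections therefore come from inclusions of sets of roots. These rest on one fact: modulo `δ₂`
a root is an integral combination of `α₀, …, αₛ` with coefficients of one sign (`exists_int_coeff`),
because the marks `kᵢ` of `θ` bound the coefficients of all roots of `𝔤`.

All the modules are treated by one triangular decomposition. An element `f` of `𝔥̂` splits the root
spaces by whether `β(f)` is negative in the lexicographic order of `ℂ`. The choices `f = φ` and `f =
f_𝒜` give the subalgebras for `M(λ)` and `M(λ, 𝒜)`. The complex element `φ + √-1 α₋₁^*` gives `ℐ`,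
where ties for `φ` are broken by the multiple of `δ₂`.

Freeness: `U(𝔞)`, with `𝔞` the negative part, is made into an `L`-module in which `1` behaves like
the generator (`exists_retraction`). This requires `λ` to vanish on brackets of opposite root spaces
with `β(f) = 0`. That is checked in `apply_eq_zero_of_lie`, where the normalization of the form
identifies `θ` with a multiple of `θ^∨`.

Unique quotients: the generator is an eigenvector of `f`, and the rest of the module has strictly
lower eigenvalues, so no proper submodule sees the generator. This is applied to the imaginary Verma
module. Its nonzero quotients, `M(λ)` and `M(λ, 𝒜)`, inherit the same irreducible quotient.

Injectivity: a homomorphism `M(λ) → M(μ)` is right multiplication by an element of `U(𝔗₋)`, and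
`U(𝔗₋)` is a domain. The proof of the latter does not use the PBW theorem: elements of `U(L)` act as
differential operators on a polynomial ring, and leading symbols are read off from the values on
powers `f ^ n` (`eq_zero_or_eq_zero_of_derivations`). -/

noncomputable section

namespace UniversalEnvelopingAlgebra

attribute [local instance 100] LieRing.ofAssociativeRing

/-! ### Induction over enveloping algebras. -/

section Induction

variable {K : Type*} [CommRing K] {L : Type*} [LieRing L] [LieAlgebra K L]

/-- Induction principle: a property which holds for `1` and is stable under linear combinations and
under left multiplication by elements of `L` holds on all of `U(L)`. -/
theorem induction_left {P : UniversalEnvelopingAlgebra K L → Prop} (one : P 1)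
    (add : ∀ u v, P u → P v → P (u + v)) (smul : ∀ (c : K) u, P u → P (c • u))
    (ι_mul : ∀ x u, P u → P (ι K x * u)) (u : UniversalEnvelopingAlgebra K L) : P u := by
  let A : Subalgebra K (UniversalEnvelopingAlgebra K L) :=
    { carrier := {a | ∀ u, P u → P (a * u)}
      mul_mem' := fun {a b} ha hb u hu ↦ by rw [mul_assoc]; exact ha _ (hb _ hu)
      add_mem' := fun {a b} ha hb u hu ↦ by rw [add_mul]; exact add _ _ (ha _ hu) (hb _ hu)
      algebraMap_mem' := fun c u hu ↦ by rw [← Algebra.smul_def]; exact smul c u hu }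
  let f : L →ₗ⁅K⁆ A :=
    { toFun := fun x ↦ ⟨ι K x, fun u hu ↦ ι_mul x u hu⟩
      map_add' := fun x y ↦ Subtype.ext (by simp)
      map_smul' := fun c x ↦ Subtype.ext (by simp)
      map_lie' := fun {x y} ↦ Subtype.ext (by simp [LieRing.of_associative_ring_bracket]) }
  have h : A.val.comp (lift K f) = AlgHom.id K _ := by
    apply hom_ext
    ext x
    change ((lift K f (ι K x) : A) : UniversalEnvelopingAlgebra K L) = ι K x
    rw [lift_ι_apply]
    rfl
  have hu : (lift K f u : UniversalEnvelopingAlgebra K L) = u := DFunLike.congr_fun h u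
  have := (lift K f u).2 1 one
  rwa [mul_one, hu] at this

end Induction

/-! ### The length filtration of `U(L)` and symbols. -/

section Words

variable {K : Type*} [Field K] {L : Type*} [LieRing L] [LieAlgebra K L]
variable {κ : Type*} (B : Module.Basis κ K L)

/-- The product in `U(L)` of a list of basis elements. -/
def word (l : List κ) : UniversalEnvelopingAlgebra K L := (l.map fun i ↦ ι K (B i)).prod

@[simp] lemma word_nil : word B [] = 1 := rfl

@[simp] lemma word_cons (i : κ) (l : List κ) : word B (i :: l) = ι K (B i) * word B l := by
  simp [word]

lemma word_append (l l' : List κ) : word B (l ++ l') = word B l * word B l' := by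
  simp [word]

/-- The span of the products of fewer than `n` basis elements. -/
def wordSpan (n : ℕ) : Submodule K (UniversalEnvelopingAlgebra K L) :=
  Submodule.span K (word B '' {l | l.length < n})

variable {B}

lemma word_mem_wordSpan {l : List κ} {n : ℕ} (h : l.length < n) : word B l ∈ wordSpan B n :=
  Submodule.subset_span ⟨l, h, rfl⟩

lemma wordSpan_mono {m n : ℕ} (h : m ≤ n) : wordSpan B m ≤ wordSpan B n :=
  Submodule.span_mono (Set.image_mono fun _ hl ↦ lt_of_lt_of_le hl h)

lemma wordSpan_zero : wordSpan B 0 = ⊥ := by simp [wordSpan]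

lemma ι_mul_mem_wordSpan (x : L) {n : ℕ} {u : UniversalEnvelopingAlgebra K L}
    (hu : u ∈ wordSpan B n) : ι K x * u ∈ wordSpan B (n + 1) := by
  induction B.mem_span x using Submodule.span_induction with
  | zero => simp
  | add x y _ _ hx hy => rw [map_add, add_mul]; exact add_mem hx hy
  | smul c x _ hx => rw [map_smul, smul_mul_assoc]; exact Submodule.smul_mem _ c hx
  | mem x hx =>
    obtain ⟨i, rfl⟩ := hx
    induction hu using Submodule.span_induction with
    | zero => simp
    | add x y _ _ hx hy => rw [mul_add]; exact add_mem hx hy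
    | smul c x _ hx => rw [mul_smul_comm]; exact Submodule.smul_mem _ c hx
    | mem u hu =>
      obtain ⟨l, hl, rfl⟩ := hu
      rw [← word_cons]
      exact word_mem_wordSpan (by simpa using hl)

/-- Lengths below `m` and below `n` add up to at most `m + n - 2`, hence the gain of one in the
bound. -/
lemma wordSpan_mul_le {m n k : ℕ} (h : m + n ≤ k + 1) :
    wordSpan B m * wordSpan B n ≤ wordSpan B k := by
  rw [wordSpan, wordSpan, Submodule.span_mul_span, Submodule.span_le]
  rintro _ ⟨_, ⟨l, hl, rfl⟩, _, ⟨l', hl', rfl⟩, rfl⟩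
  simp only [Set.mem_ofPred_eq] at hl hl'
  simp only [← word_append]
  exact word_mem_wordSpan (by rw [List.length_append]; omega)

lemma exists_mem_wordSpan (u : UniversalEnvelopingAlgebra K L) : ∃ n, u ∈ wordSpan B n := by
  induction u using induction_left with
  | one => exact ⟨1, word_mem_wordSpan (l := []) (by simp)⟩
  | add u v hu hv =>
    obtain ⟨m, hm⟩ := hu
    obtain ⟨n, hn⟩ := hv
    exact ⟨max m n, add_mem (wordSpan_mono (le_max_left _ _) hm)
      (wordSpan_mono (le_max_right _ _) hn)⟩
  | smul c u hu => exact hu.imp fun n hn ↦ Submodule.smul_mem _ c hn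
  | ι_mul x u hu =>
    obtain ⟨n, hn⟩ := hu
    exact ⟨n + 1, ι_mul_mem_wordSpan x hn⟩

/-- Up to products of smaller length, the order of the factors does not matter. -/
lemma word_sub_word_mem {l l' : List κ} (h : l.Perm l') :
    word B l - word B l' ∈ wordSpan B l.length := by
  induction h with
  | nil => simp
  | cons i h ih =>
    rw [word_cons, word_cons, ← mul_sub]
    exact ι_mul_mem_wordSpan _ ih
  | swap i j l =>
    have : word B (j :: i :: l) - word B (i :: j :: l) = ι K ⁅B j, B i⁆ * word B l := by
      simp only [word_cons, LieHom.map_lie, LieRing.of_associative_ring_bracket]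
      noncomm_ring
    rw [this]
    exact ι_mul_mem_wordSpan _ (word_mem_wordSpan (by simp))
  | trans h₁ h₂ ih₁ ih₂ =>
    rw [← sub_add_sub_cancel]
    exact add_mem ih₁ (h₁.length_eq ▸ ih₂)

variable (B)

/-- The span of the pairs consisting of a product of `n` basis elements and of the monomial with the
same factors. -/
def symbolGraph (n : ℕ) : Submodule K (UniversalEnvelopingAlgebra K L × MvPolynomial κ K) :=
  Submodule.span K
    ((fun l ↦ (word B l, (l.map MvPolynomial.X).prod)) '' {l : List κ | l.length = n})

variable {B}

/-- The symbol is kept as a relation and not as a map, so that no well-definedness has to be proved.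
Multiplicativity of the relation is all that the domain argument needs. -/
lemma symbolGraph_mul_le (m n : ℕ) :
    symbolGraph B m * symbolGraph B n ≤ symbolGraph B (m + n) := by
  rw [symbolGraph, symbolGraph, Submodule.span_mul_span, Submodule.span_le]
  rintro _ ⟨_, ⟨l, hl, rfl⟩, _, ⟨l', hl', rfl⟩, rfl⟩
  refine Submodule.subset_span ⟨l ++ l', ?_, ?_⟩
  · simp only [Set.mem_ofPred_eq] at hl hl' ⊢
    simp [hl, hl']
  · simp [word_append]

/-- Every element of filtration degree `n` has a symbol of degree `n`, whose vanishing means that the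
filtration degree is smaller. -/
lemma exists_symbol {n : ℕ} {u : UniversalEnvelopingAlgebra K L} (hu : u ∈ wordSpan B (n + 1)) :
    ∃ (u' : UniversalEnvelopingAlgebra K L) (q : MvPolynomial κ K), (u', q) ∈ symbolGraph B n ∧
      u - u' ∈ wordSpan B n ∧ (q = 0 → u' = 0) := by
  -- `Q` chooses one ordering for each commutative monomial. With `u' = Q q`, the last clause of the
  -- statement is linearity of `Q`.
  let Q : MvPolynomial κ K →ₗ[K] UniversalEnvelopingAlgebra K L :=
    (MvPolynomial.basisMonomials κ K).constr K fun m ↦ word B (Finsupp.toMultiset m).toList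
  have hQ (l : List κ) : ∃ l' : List κ, l.Perm l' ∧ Q (l.map MvPolynomial.X).prod = word B l' := by
    classical
    refine ⟨(l : Multiset κ).toList, ?_, ?_⟩
    · rw [← Multiset.coe_eq_coe, Multiset.coe_toList]
    · have h1 : (l.map (MvPolynomial.X (R := K))).prod =
          MvPolynomial.basisMonomials κ K (Multiset.toFinsupp (l : Multiset κ)) := by
        rw [MvPolynomial.coe_basisMonomials]
        induction l with
        | nil => simp
        | cons i l ih =>
          rw [List.map_cons, List.prod_cons, ih, ← Multiset.cons_coe, ← Multiset.singleton_add,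
            map_add, Multiset.toFinsupp_singleton, MvPolynomial.X, MvPolynomial.monomial_mul,
            one_mul]
      rw [h1]
      simp only [Q, Module.Basis.constr_basis, Multiset.toFinsupp_toMultiset]
  suffices ∃ q, (Q q, q) ∈ symbolGraph B n ∧ u - Q q ∈ wordSpan B n by
    obtain ⟨q, h1, h2⟩ := this
    exact ⟨Q q, q, h1, h2, fun h ↦ by rw [h, map_zero]⟩
  induction hu using Submodule.span_induction with
  | zero => exact ⟨0, by simp [← Prod.zero_eq_mk], by simp⟩
  | add u v _ _ hu hv =>
    obtain ⟨q, h1, h2⟩ := hu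
    obtain ⟨r, h3, h4⟩ := hv
    refine ⟨q + r, ?_, ?_⟩
    · rw [map_add, ← Prod.mk_add_mk]
      exact add_mem h1 h3
    · rw [map_add, add_sub_add_comm]
      exact add_mem h2 h4
  | smul c u _ hu =>
    obtain ⟨q, h1, h2⟩ := hu
    refine ⟨c • q, ?_, ?_⟩
    · rw [map_smul, ← Prod.smul_mk]
      exact Submodule.smul_mem _ c h1
    · rw [map_smul, ← smul_sub]
      exact Submodule.smul_mem _ c h2
  | mem u hu =>
    obtain ⟨l, hl, rfl⟩ := hu
    rcases Nat.lt_succ_iff_lt_or_eq.mp hl with h | h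
    · exact ⟨0, by simp [← Prod.zero_eq_mk], by simpa using word_mem_wordSpan h⟩
    · obtain ⟨l', hp, hq⟩ := hQ l
      refine ⟨(l.map MvPolynomial.X).prod, ?_, ?_⟩
      · rw [hq, (hp.map _).prod_eq]
        exact Submodule.subset_span ⟨l', by simp [← hp.length_eq, h], rfl⟩
      · rw [hq, ← h]
        exact word_sub_word_mem hp

end Words

/-! ### Elements of `U(L)` as differential operators. -/

section Derivations

variable {K : Type*} [Field K] {L : Type*} [LieRing L] [LieAlgebra K L]
variable {S : Type*} [CommRing S] [Algebra K S]

/-- The action of `U(L)` on an algebra on which `L` acts by derivations. -/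
def derivationAction (D : L →ₗ⁅K⁆ Derivation K S S) :
    UniversalEnvelopingAlgebra K L →ₐ[K] Module.End K S :=
  lift K
    { toFun := fun x ↦ (D x : S →ₗ[K] S)
      map_add' := fun x y ↦ by ext; simp
      map_smul' := fun c x ↦ by ext; simp
      map_lie' := fun {x y} ↦ by
        ext
        simp [LieRing.of_associative_ring_bracket] }

@[simp] lemma derivationAction_ι (D : L →ₗ⁅K⁆ Derivation K S S) (x : L) (s : S) :
    derivationAction D (ι K x) s = D x s := by
  rw [derivationAction, lift_ι_apply]
  rfl

variable {κ : Type*} (B : Module.Basis κ K L) (D : L →ₗ⁅K⁆ Derivation K S S)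

/-- A product of `n` derivations applied to `f ^ (n + k)`, modulo `f ^ (k + 1)`. -/
lemma exists_word_apply_pow (l : List κ) (f : S) (k : ℕ) :
    ∃ s, derivationAction D (word B l) (f ^ (l.length + k)) =
      (k + 1).ascFactorial l.length * f ^ k * (l.map fun i ↦ D (B i) f).prod + f ^ (k + 1) * s := by
  induction l generalizing k with
  | nil => exact ⟨0, by simp⟩
  | cons i l ih =>
    obtain ⟨s, hs⟩ := ih (k + 1)
    have e : (i :: l).length + k = l.length + (k + 1) := by simp; ring
    rw [word_cons, map_mul, Module.End.mul_apply, e, hs, derivationAction_ι]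
    set g := (l.map fun i ↦ D (B i) f).prod with hg
    -- The outer derivation turns `f ^ (k + 1)` into `(k + 1) f ^ k D f`, and `k + 1` extends the
    -- rising factorial. All other Leibniz terms keep a factor `f ^ (k + 1)`; the witness is what
    -- remains of them.
    refine ⟨(k + 2).ascFactorial l.length * D (B i) g + (k + 2) * D (B i) f * s +
      f * D (B i) s, ?_⟩
    have h : ((k + 1 : ℕ) : S) * (k + 2).ascFactorial l.length =
        (k + 1).ascFactorial (l.length + 1) := by
      rw [← Nat.cast_mul, Nat.ascFactorial_succ, ← Nat.succ_ascFactorial]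
    simp only [map_add, Derivation.leibniz, Derivation.leibniz_pow, Derivation.map_natCast,
      smul_eq_mul, nsmul_eq_mul, List.length_cons, List.map_cons, List.prod_cons, ← hg, ← h]
    simp only [Nat.add_sub_cancel, show k + 1 + 1 - 1 = k + 1 from rfl]
    push_cast
    ring

/-- An operator of order below `n` leaves at least one factor `f` in every term of the Leibniz
expansion of `f ^ n`. -/
lemma apply_pow_eq_zero_of_mem_wordSpan (p : S →ₐ[K] K) {f : S} (hf : p f = 0)
    {n : ℕ} {u : UniversalEnvelopingAlgebra K L}
    (hu : u ∈ wordSpan B n) : p (derivationAction D u (f ^ n)) = 0 := by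
  induction hu using Submodule.span_induction with
  | zero => simp
  | add u v _ _ hu hv => simp [hu, hv]
  | smul c u _ hu => simp [hu]
  | mem u hu =>
    obtain ⟨l, hl, rfl⟩ := hu
    obtain ⟨k, rfl⟩ : ∃ k, n = l.length + (k + 1) := Nat.exists_eq_add_of_lt hl
    obtain ⟨s, hs⟩ := exists_word_apply_pow B D l f (k + 1)
    rw [hs]
    simp [hf]

/-- At `p` only those Leibniz terms survive in which the `n` derivations hit `n` different factors.
There are `n!` of them, and together they evaluate the symbol at the differential of `f`. -/
lemma apply_pow_eq_eval_of_mem_symbolGraph (p : S →ₐ[K] K) {f : S} (hf : p f = 0)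
    {n : ℕ} {u : UniversalEnvelopingAlgebra K L}
    {q : MvPolynomial κ K} (h : (u, q) ∈ symbolGraph B n) :
    p (derivationAction D u (f ^ n)) =
      n.factorial * MvPolynomial.eval (fun i ↦ p (D (B i) f)) q := by
  suffices ∀ a ∈ symbolGraph B n, p (derivationAction D a.1 (f ^ n)) =
      n.factorial * MvPolynomial.eval (fun i ↦ p (D (B i) f)) a.2 from this _ h
  intro a ha
  induction ha using Submodule.span_induction with
  | zero => simp
  | add u v _ _ hu hv => simp [hu, hv, mul_add]
  | smul c u _ hu => simp [hu, mul_left_comm]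
  | mem u hu =>
    obtain ⟨l, rfl, rfl⟩ := hu
    obtain ⟨s, hs⟩ := exists_word_apply_pow B D l f 0
    rw [add_zero] at hs
    simp [hs, hf, map_list_prod, Function.comp_def, Nat.one_ascFactorial]

end Derivations

/-! ### Enveloping algebras without zero divisors. -/

section Domain

variable {K : Type*} [Field K] {L : Type*} [LieRing L] [LieAlgebra K L]

/-- Finitely many linearly independent functionals take arbitrary prescribed values. -/
lemma exists_forall_dual_apply_eq {ι : Type*} [Fintype ι] {W : Type*} [AddCommGroup W] [Module K W]
    (ξ : ι → Module.Dual K W) (hξ : LinearIndependent K ξ) (g : ι → K) :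
    ∃ w, ∀ i, ξ i w = g i := by
  classical
  suffices LinearMap.range (LinearMap.pi ξ) = ⊤ by
    obtain ⟨w, hw⟩ := LinearMap.range_eq_top.mp this g
    exact ⟨w, fun i ↦ congrFun hw i⟩
  by_contra hE
  -- A nonzero functional vanishing on the image is a nontrivial linear relation between the `ξ i`.
  obtain ⟨ψ, hψ, hle⟩ := Submodule.exists_le_ker_of_lt_top _ (lt_top_iff_ne_top.mpr hE)
  have hc (a : ι → K) : ψ a = ∑ i, ψ (Pi.single i 1) * a i := by
    conv_lhs => rw [← Finset.univ_sum_single a]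
    rw [map_sum]
    refine Finset.sum_congr rfl fun i _ ↦ ?_
    rw [mul_comm, ← smul_eq_mul, ← map_smul, ← Pi.single_smul, smul_eq_mul, mul_one]
  have h0 := Fintype.linearIndependent_iff.mp hξ (fun i ↦ ψ (Pi.single i 1)) <|
    LinearMap.ext fun w ↦ by
      have h1 : ψ (LinearMap.pi ξ w) = 0 := hle ⟨w, rfl⟩
      rw [hc] at h1
      simpa using h1
  refine hψ (LinearMap.ext fun a ↦ ?_)
  rw [hc]
  simp [h0]

/-- The functions vanishing at `p` have arbitrary derivatives in finitely many linearly independent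
directions, provided that no nonzero element of `L` acts by zero at `p`. -/
lemma exists_apply_eq_of_derivations {S : Type*} [CommRing S] [Algebra K S]
    {κ : Type*} (B : Module.Basis κ K L) (D : L →ₗ⁅K⁆ Derivation K S S) (p : S →ₐ[K] K)
    (hD : ∀ x, (∀ f, p f = 0 → p (D x f) = 0) → x = 0) (s : Finset κ) (g : κ → K) :
    ∃ f, p f = 0 ∧ ∀ i ∈ s, p (D (B i) f) = g i := by
  let Ξ : L →ₗ[K] Module.Dual K (LinearMap.ker p.toLinearMap) :=
    { toFun := fun x ↦ p.toLinearMap ∘ₗ (D x : S →ₗ[K] S) ∘ₗ Submodule.subtype _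
      map_add' := fun x y ↦ by ext; simp
      map_smul' := fun c x ↦ by ext; simp }
  have hΞ : LinearMap.ker Ξ = ⊥ := by
    refine LinearMap.ker_eq_bot'.mpr fun x hx ↦ hD x fun f hf ↦ ?_
    exact DFunLike.congr_fun hx ⟨f, hf⟩
  obtain ⟨f, hf⟩ := exists_forall_dual_apply_eq (ι := s) (fun i ↦ Ξ (B i))
    ((B.linearIndependent.comp ((↑) : s → κ) Subtype.val_injective).map' Ξ hΞ) (fun i ↦ g i)
  exact ⟨f, f.2, fun i hi ↦ hf ⟨i, hi⟩⟩

/-- If `L` acts by derivations on a commutative algebra with an augmentation `p`, and if no nonzero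
element of `L` acts by zero at `p`, then `U(L)` has no zero divisors. -/
theorem eq_zero_or_eq_zero_of_derivations [CharZero K] {S : Type*} [CommRing S] [Algebra K S]
    (D : L →ₗ⁅K⁆ Derivation K S S) (p : S →ₐ[K] K)
    (hD : ∀ x, (∀ f, p f = 0 → p (D x f) = 0) → x = 0)
    {u v : UniversalEnvelopingAlgebra K L} (huv : u * v = 0) : u = 0 ∨ v = 0 := by
  classical
  obtain ⟨κ, ⟨B⟩⟩ : ∃ κ, Nonempty (Module.Basis κ K L) := ⟨_, ⟨Module.Basis.ofVectorSpace K L⟩⟩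
  -- A polynomial has finitely many variables, on which the differential of some `f` takes any
  -- prescribed values; over an infinite field this forces `q = 0`.
  have hzero (q : MvPolynomial κ K)
      (hq : ∀ f, p f = 0 → MvPolynomial.eval (fun i ↦ p (D (B i) f)) q = 0) : q = 0 := by
    refine MvPolynomial.funext fun g ↦ ?_
    obtain ⟨f, hf, hfg⟩ := exists_apply_eq_of_derivations B D p hD q.vars g
    rw [map_zero, ← hq f hf]
    exact MvPolynomial.hom_congr_vars (by ext; simp) (fun i hi _ ↦ by simp [hfg i hi]) rfl
  -- Here `n` is the exact filtration degree of `w`, one less than the minimal index because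
  -- `wordSpan` is defined by a strict inequality. Minimality makes the symbol nonzero.
  have key (w : UniversalEnvelopingAlgebra K L) (hw : w ≠ 0) :
      ∃ n w' q, (w', q) ∈ symbolGraph B n ∧ w - w' ∈ wordSpan B n ∧ w ∈ wordSpan B (n + 1) ∧
        w' ∈ wordSpan B (n + 1) ∧ q ≠ 0 := by
    have hex := exists_mem_wordSpan (B := B) w
    obtain ⟨n, hn⟩ : ∃ n, Nat.find hex = n + 1 := by
      refine Nat.exists_eq_succ_of_ne_zero fun h ↦ hw ?_
      have := Nat.find_spec hex
      rw [h, wordSpan_zero] at this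
      exact this
    have hmem : w ∈ wordSpan B (n + 1) := hn ▸ Nat.find_spec hex
    obtain ⟨w', q, h1, h2, h3⟩ := exists_symbol hmem
    refine ⟨n, w', q, h1, h2, hmem, ?_, fun hq ↦ ?_⟩
    · rw [← sub_sub_cancel w w']
      exact sub_mem hmem (wordSpan_mono n.le_succ h2)
    · rw [h3 hq, sub_zero] at h2
      exact Nat.find_min hex (by omega) h2
  by_contra! hne
  obtain ⟨m, u', q, hq1, hq2, hq3, hq4, hq5⟩ := key u hne.1
  obtain ⟨n, v', r, hr1, hr2, hr3, hr4, hr5⟩ := key v hne.2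
  -- Since `u * v = 0`, the product `u' * v'` has order below `m + n`, so it kills `f ^ (m + n)` at
  -- `p`; but there it also computes `(m + n)!` times the value of `q * r`.
  refine mul_ne_zero hq5 hr5 (hzero _ fun f hf ↦ ?_)
  have h1 := apply_pow_eq_eval_of_mem_symbolGraph B D p hf
    (symbolGraph_mul_le m n (Submodule.mul_mem_mul hq1 hr1))
  have h2 : u' * v' ∈ wordSpan B (m + n) := by
    have e : u' * v' = -((u - u') * v + u' * (v - v')) := by
      rw [sub_mul, mul_sub, huv]
      abel
    rw [e]
    exact neg_mem (add_mem (wordSpan_mul_le (by omega) (Submodule.mul_mem_mul hq2 hr3))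
      (wordSpan_mul_le (by omega) (Submodule.mul_mem_mul hq4 hr2)))
  rw [apply_pow_eq_zero_of_mem_wordSpan B D p hf h2] at h1
  exact (mul_eq_zero.mp h1.symm).resolve_left (Nat.cast_ne_zero.mpr (Nat.factorial_ne_zero _))

/-- If `L` has a faithful representation, then `U(L)` has no zero divisors. -/
theorem eq_zero_or_eq_zero_of_faithful [CharZero K] (V : Type*) [AddCommGroup V] [Module K V]
    [LieRingModule L V] [LieModule K L V] (hV : ∀ x : L, (∀ v : V, ⁅x, v⁆ = 0) → x = 0)
    {u v : UniversalEnvelopingAlgebra K L} (huv : u * v = 0) : u = 0 ∨ v = 0 := by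
  let b := Module.Basis.ofVectorSpace K V
  -- The polynomial ring in `σ` is the symmetric algebra of a sum of copies of `V`, one for each
  -- functional `φ`, and `lin φ` embeds the copy with index `φ`. The action of `L` on the copies
  -- extends to derivations.
  let σ := Module.Basis.ofVectorSpaceIndex K V × Module.Dual K V
  let lin (φ : Module.Dual K V) : V →ₗ[K] MvPolynomial σ K :=
    b.constr K fun i ↦ MvPolynomial.X (i, φ)
  have hlin (φ i) : lin φ (b i) = MvPolynomial.X (i, φ) := b.constr_basis K _ i
  let δ (x : L) : Derivation K (MvPolynomial σ K) (MvPolynomial σ K) :=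
    MvPolynomial.mkDerivation K fun i ↦ lin i.2 ⁅x, b i.1⁆
  have hδ (x : L) (φ) (w : V) : δ x (lin φ w) = lin φ ⁅x, w⁆ := by
    induction b.mem_span w using Submodule.span_induction with
    | zero => simp
    | add u v _ _ hu hv => simp [hu, hv]
    | smul c u _ hu => simp [hu]
    | mem u hu =>
      obtain ⟨i, rfl⟩ := hu
      rw [hlin, MvPolynomial.mkDerivation_X]
  have hX (i : σ) : MvPolynomial.X i = lin i.2 (b i.1) := (hlin _ _).symm
  let D : L →ₗ⁅K⁆ Derivation K (MvPolynomial σ K) (MvPolynomial σ K) :=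
    { toFun := δ
      map_add' := fun x y ↦ MvPolynomial.derivation_ext fun i ↦ by
        simp [hX, hδ]
      map_smul' := fun c x ↦ MvPolynomial.derivation_ext fun i ↦ by
        simp [hX, hδ]
      map_lie' := fun {x y} ↦ MvPolynomial.derivation_ext fun i ↦ by
        simp [hX, hδ, Derivation.commutator_apply] }
  -- The augmentation is `φ` itself on the copy with index `φ`, so the derivatives at `p` are the
  -- matrix coefficients `φ ⁅x, w⁆`, which detect `x` by faithfulness.
  let p : MvPolynomial σ K →ₐ[K] K := MvPolynomial.aeval fun i ↦ i.2 (b i.1)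
  have hp (φ : Module.Dual K V) (w : V) : p (lin φ w) = φ w := by
    induction b.mem_span w using Submodule.span_induction with
    | zero => simp
    | add u v _ _ hu hv => simp [hu, hv]
    | smul c u _ hu => simp [hu]
    | mem u hu =>
      obtain ⟨i, rfl⟩ := hu
      rw [hlin, MvPolynomial.aeval_X]
  refine eq_zero_or_eq_zero_of_derivations D p (fun x hx ↦ hV x fun w ↦ ?_) huv
  refine (Module.forall_dual_apply_eq_zero_iff K _).mp fun φ ↦ ?_
  have h := hx (lin φ w - MvPolynomial.C (φ w)) (by rw [map_sub, hp]; simp [p])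
  have e : D x (lin φ w - MvPolynomial.C (φ w)) = lin φ ⁅x, w⁆ := by
    rw [map_sub, MvPolynomial.derivation_C, sub_zero]
    exact hδ x φ w
  rwa [e, hp] at h

end Domain

end UniversalEnvelopingAlgebra

namespace UniversalEnvelopingAlgebra

attribute [local instance 100] LieRing.ofAssociativeRing

/-! ### Modules induced from a one-dimensional representation. -/

section Induced

variable {K : Type*} [CommRing K] {L : Type*} [LieRing L] [LieAlgebra K L]
variable (𝔞 : LieSubalgebra K L)

/-- The map `U(𝔞) → U(L)` induced by the inclusion of a subalgebra. -/
def inclMap : UniversalEnvelopingAlgebra K 𝔞 →ₐ[K] UniversalEnvelopingAlgebra K L :=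
  lift K ((ι K).comp 𝔞.incl)

@[simp] lemma inclMap_ι (a : 𝔞) : inclMap 𝔞 (ι K a) = ι K (a : L) := by
  rw [inclMap, lift_ι_apply]
  rfl

/-- The natural action of a subalgebra `𝔞` of `L` on the linear maps from `L` to `U(𝔞)`. -/
def homAction : 𝔞 →ₗ⁅K⁆ Module.End K (L →ₗ[K] UniversalEnvelopingAlgebra K 𝔞) where
  toFun a :=
    { toFun := fun F ↦ LinearMap.mulLeft K (ι K a) ∘ₗ F - F ∘ₗ LieAlgebra.ad K L (a : L)
      map_add' := fun F G ↦ by ext x; simp [mul_add]; abel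
      map_smul' := fun c F ↦ by ext x; simp [smul_sub] }
  map_add' a b := by ext F x; simp [add_mul]; abel
  map_smul' c a := by ext F x; simp [smul_sub]
  map_lie' {a b} := by
    ext F x
    simp only [LinearMap.coe_mk, AddHom.coe_mk, LinearMap.sub_apply, LinearMap.comp_apply,
      LinearMap.mulLeft_apply, LieRing.of_associative_ring_bracket, Module.End.mul_apply,
      LieHom.map_lie, LieSubalgebra.coe_bracket, LieAlgebra.ad_apply, map_sub]
    noncomm_ring

lemma homAction_apply (a : 𝔞) (F : L →ₗ[K] UniversalEnvelopingAlgebra K 𝔞) (x : L) :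
    homAction 𝔞 a F x = ι K a * F x - F ⁅(a : L), x⁆ := rfl

variable {𝔞}

/-- The operators on `U(𝔞)` by which the elements of `L` act in the induced module, given their
values `F x` on the generator. -/
def inducedOp (F : L →ₗ[K] UniversalEnvelopingAlgebra K 𝔞) (x : L)
    (u : UniversalEnvelopingAlgebra K 𝔞) : UniversalEnvelopingAlgebra K 𝔞 :=
  lift K (homAction 𝔞) u F x

variable (F : L →ₗ[K] UniversalEnvelopingAlgebra K 𝔞)

lemma inducedOp_one (x : L) : inducedOp F x 1 = F x := by simp [inducedOp]

lemma inducedOp_add_right (x : L) (u v : UniversalEnvelopingAlgebra K 𝔞) :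
    inducedOp F x (u + v) = inducedOp F x u + inducedOp F x v := by simp [inducedOp]

lemma inducedOp_smul_right (x : L) (c : K) (u : UniversalEnvelopingAlgebra K 𝔞) :
    inducedOp F x (c • u) = c • inducedOp F x u := by simp [inducedOp]

lemma inducedOp_sub_right (x : L) (u v : UniversalEnvelopingAlgebra K 𝔞) :
    inducedOp F x (u - v) = inducedOp F x u - inducedOp F x v := by simp [inducedOp]

lemma inducedOp_add_left (x y : L) (u : UniversalEnvelopingAlgebra K 𝔞) :
    inducedOp F (x + y) u = inducedOp F x u + inducedOp F y u := by simp [inducedOp]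

lemma inducedOp_smul_left (c : K) (x : L) (u : UniversalEnvelopingAlgebra K 𝔞) :
    inducedOp F (c • x) u = c • inducedOp F x u := by simp [inducedOp]

/-- This is `x a = a x - [a, x]`, which any action extending left multiplication by `𝔞` must
satisfy. It determines the operators from their values `F x` at `1`. -/
lemma inducedOp_ι_mul (x : L) (a : 𝔞) (u : UniversalEnvelopingAlgebra K 𝔞) :
    inducedOp F x (ι K a * u) = ι K a * inducedOp F x u - inducedOp F ⁅(a : L), x⁆ u := by
  rw [inducedOp, map_mul, Module.End.mul_apply, lift_ι_apply, homAction_apply]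
  rfl

variable {F}

lemma inducedOp_coe (hF : ∀ a : 𝔞, F a = ι K a) (a : 𝔞) (u : UniversalEnvelopingAlgebra K 𝔞) :
    inducedOp F a u = ι K a * u := by
  induction u using induction_left generalizing a with
  | one => rw [inducedOp_one, hF, mul_one]
  | add u v hu hv => rw [inducedOp_add_right, hu, hv, mul_add]
  | smul c u hu => rw [inducedOp_smul_right, hu, mul_smul_comm]
  | ι_mul b u hu =>
    rw [inducedOp_ι_mul, ← LieSubalgebra.coe_bracket, hu, hu, LieHom.map_lie,
      LieRing.of_associative_ring_bracket]
    noncomm_ring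

/-- The operators `inducedOp` define a representation of `L = 𝔞 + 𝔭`, if the values on `𝔭` are
scalars and those on `[𝔭, 𝔭]` are zero. -/
lemma inducedOp_lie (hF : ∀ a : 𝔞, F a = ι K a) (𝔭 : Submodule K L)
    (hsup : 𝔞.toSubmodule ⊔ 𝔭 = ⊤) (hscal : ∀ x ∈ 𝔭, ∃ c, F x = algebraMap K _ c)
    (hlie : ∀ x ∈ 𝔭, ∀ y ∈ 𝔭, F ⁅x, y⁆ = 0) (x y : L) (u : UniversalEnvelopingAlgebra K 𝔞) :
    inducedOp F ⁅x, y⁆ u =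
      inducedOp F x (inducedOp F y u) - inducedOp F y (inducedOp F x u) := by
  -- When one of the two elements lies in `𝔞`, the relation is built into the construction; only
  -- pairs from `𝔭` carry a condition.
  have left (a : 𝔞) (y : L) (u : UniversalEnvelopingAlgebra K 𝔞) : inducedOp F ⁅(a : L), y⁆ u =
      inducedOp F a (inducedOp F y u) - inducedOp F y (inducedOp F a u) := by
    rw [inducedOp_coe hF, inducedOp_coe hF, inducedOp_ι_mul]
    abel
  have right (a : 𝔞) (x : L) (u : UniversalEnvelopingAlgebra K 𝔞) : inducedOp F ⁅x, (a : L)⁆ u =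
      inducedOp F x (inducedOp F a u) - inducedOp F a (inducedOp F x u) := by
    rw [← lie_skew, ← neg_one_smul K, inducedOp_smul_left, left, neg_one_smul, neg_sub]
  induction u using induction_left generalizing x y with
  | add u v hu hv => simp only [inducedOp_add_right, hu, hv]; abel
  | smul c u hu => simp only [inducedOp_smul_right, hu, smul_sub]
  | ι_mul a u hu =>
    rw [inducedOp_ι_mul, inducedOp_ι_mul, inducedOp_ι_mul, leibniz_lie, inducedOp_add_left,
      hu ⁅(a : L), x⁆ y, hu x ⁅(a : L), y⁆, hu x y, inducedOp_sub_right, inducedOp_sub_right,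
      inducedOp_ι_mul, inducedOp_ι_mul, mul_sub]
    abel
  -- At `1`, bilinearity reduces everything to a pair in `𝔭`: the operators act there by scalars,
  -- which commute, and `F` kills the bracket.
  | one =>
    obtain ⟨a, ha, p, hp, rfl⟩ := Submodule.mem_sup.mp (hsup ▸ Submodule.mem_top : x ∈ _ ⊔ 𝔭)
    obtain ⟨a', ha', q, hq, rfl⟩ := Submodule.mem_sup.mp (hsup ▸ Submodule.mem_top : y ∈ _ ⊔ 𝔭)
    have hpq : inducedOp F ⁅p, q⁆ 1 =
        inducedOp F p (inducedOp F q 1) - inducedOp F q (inducedOp F p 1) := by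
      obtain ⟨c, hc⟩ := hscal p hp
      obtain ⟨d, hd⟩ := hscal q hq
      simp only [inducedOp_one, hlie p hp q hq, hc, hd, Algebra.algebraMap_eq_smul_one,
        inducedOp_smul_right]
      rw [smul_comm, sub_self]
    have h1 := left ⟨a, ha⟩
    have h2 := right ⟨a', ha'⟩
    simp only at h1 h2
    simp only [add_lie, lie_add, inducedOp_add_left, inducedOp_add_right, h1, h2, hpq]
    abel

/-- The module induced to `L = 𝔞 ⊕ 𝔭` from a one-dimensional representation of `𝔭` is free over
`U(𝔞)`: there is a linear retraction of `U(𝔞) → U(L)` which kills the annihilator of the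
generator. -/
theorem exists_retraction (hF : ∀ a : 𝔞, F a = ι K a) (𝔭 : Submodule K L)
    (hsup : 𝔞.toSubmodule ⊔ 𝔭 = ⊤) (hscal : ∀ x ∈ 𝔭, ∃ c, F x = algebraMap K _ c)
    (hlie : ∀ x ∈ 𝔭, ∀ y ∈ 𝔭, F ⁅x, y⁆ = 0) :
    ∃ ψ : UniversalEnvelopingAlgebra K L →ₗ[K] UniversalEnvelopingAlgebra K 𝔞,
      (∀ u, ψ (inclMap 𝔞 u) = u) ∧
      ∀ w x c, F x = algebraMap K _ c → ψ (w * ι K x) = ψ (w * algebraMap K _ c) := by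
  let ρ : L →ₗ⁅K⁆ Module.End K (UniversalEnvelopingAlgebra K 𝔞) :=
    { toFun := fun x ↦
        { toFun := inducedOp F x
          map_add' := inducedOp_add_right F x
          map_smul' := inducedOp_smul_right F x }
      map_add' := fun x y ↦ LinearMap.ext fun u ↦ inducedOp_add_left F x y u
      map_smul' := fun c x ↦ LinearMap.ext fun u ↦ inducedOp_smul_left F c x u
      map_lie' := fun {x y} ↦ LinearMap.ext fun u ↦
        inducedOp_lie hF 𝔭 hsup hscal hlie x y u }
  -- The retraction applies `w` to `1` in the module just constructed.
  refine ⟨LinearMap.applyₗ 1 ∘ₗ (lift K ρ).toLinearMap, fun u ↦ ?_, fun w x c h ↦ ?_⟩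
  · change lift K ρ (inclMap 𝔞 u) 1 = u
    induction u using induction_left with
    | one => simp
    | add u v hu hv => simp [hu, hv]
    | smul c u hu => simp [hu]
    | ι_mul a u hu =>
      rw [map_mul, inclMap_ι, map_mul, lift_ι_apply, Module.End.mul_apply, hu]
      exact inducedOp_coe hF a u
  · change lift K ρ (w * ι K x) 1 = lift K ρ (w * algebraMap K _ c) 1
    rw [map_mul, map_mul, lift_ι_apply, Module.End.mul_apply, Module.End.mul_apply]
    congr 1
    change inducedOp F x 1 = _
    rw [inducedOp_one, h, AlgHom.commutes]
    simp [Algebra.algebraMap_eq_smul_one]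

/-- If `L = 𝔞 + 𝔭` and `𝔭` acts on the generator by scalars, then the generator generates the module
over `U(𝔞)`. -/
theorem exists_inclMap_smul_eq (𝔞 : LieSubalgebra K L) (𝔭 : Submodule K L)
    (hsup : 𝔞.toSubmodule ⊔ 𝔭 = ⊤) {M : Type*} [AddCommGroup M]
    [Module (UniversalEnvelopingAlgebra K L) M] {v : M}
    (hv : ∀ x ∈ 𝔭, ∃ c : K, ι K x • v = algebraMap K (UniversalEnvelopingAlgebra K L) c • v)
    (w : UniversalEnvelopingAlgebra K L) : ∃ u, w • v = inclMap 𝔞 u • v := by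
  -- `U(𝔞) v` is stable under `L`: the element `x` is moved to the right past `𝔞` by `x a = [x, a] +
  -- a x`.
  have key (u : UniversalEnvelopingAlgebra K 𝔞) (x : L) :
      ∃ u', ι K x • inclMap 𝔞 u • v = inclMap 𝔞 u' • v := by
    induction u using induction_left generalizing x with
    | one =>
      obtain ⟨a, ha, p, hp, rfl⟩ := Submodule.mem_sup.mp (hsup ▸ Submodule.mem_top : x ∈ _ ⊔ 𝔭)
      obtain ⟨c, hc⟩ := hv p hp
      refine ⟨ι K ⟨a, ha⟩ + algebraMap K _ c, ?_⟩
      rw [map_one, one_smul, map_add, map_add, add_smul, add_smul, hc, inclMap_ι,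
        AlgHom.commutes]
    | add u v hu hv =>
      obtain ⟨u', hu'⟩ := hu x
      obtain ⟨v', hv'⟩ := hv x
      exact ⟨u' + v', by simp only [map_add, add_smul, smul_add, hu', hv']⟩
    | smul c u hu =>
      obtain ⟨u', hu'⟩ := hu x
      refine ⟨c • u', ?_⟩
      rw [map_smul, map_smul, Algebra.smul_def, Algebra.smul_def, mul_smul, mul_smul, ← hu',
        ← mul_smul, ← Algebra.commutes, mul_smul]
    | ι_mul a u hu =>
      obtain ⟨u₁, h₁⟩ := hu x
      obtain ⟨u₂, h₂⟩ := hu ⁅x, (a : L)⁆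
      refine ⟨u₂ + ι K a * u₁, ?_⟩
      rw [map_add, add_smul, ← h₂, map_mul, map_mul, mul_smul, mul_smul, ← h₁, inclMap_ι,
        LieHom.map_lie, LieRing.of_associative_ring_bracket, sub_smul, mul_smul, mul_smul,
        sub_add_cancel]
  induction w using induction_left with
  | one => exact ⟨1, by rw [map_one]⟩
  | add u v hu hv =>
    obtain ⟨u', hu'⟩ := hu
    obtain ⟨v', hv'⟩ := hv
    exact ⟨u' + v', by simp only [map_add, add_smul, hu', hv']⟩
  | smul c u hu =>
    obtain ⟨u', hu'⟩ := hu
    exact ⟨c • u', by rw [map_smul, Algebra.smul_def, Algebra.smul_def, mul_smul, mul_smul, hu']⟩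
  | ι_mul x u hu =>
    obtain ⟨u', hu'⟩ := hu
    rw [mul_smul, hu']
    exact key u' x

end Induced

end UniversalEnvelopingAlgebra

namespace DoubleAffine

/-! ### Modules with a unique maximal submodule. -/

section Radical

variable {R : Type*} [Ring R] {M : Type*} [AddCommGroup M] [Module R M]

lemma le_radical {N : Submodule R M} (hN : N ≠ ⊤) : N ≤ radical R M := le_sSup hN

lemma hasUniqueIrreducibleQuotient_of_radical_ne_top (h : radical R M ≠ ⊤) :
    HasUniqueIrreducibleQuotient R M := by
  refine ⟨⟨h, fun N hN ↦ ?_⟩, fun N hN ↦ ?_⟩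
  · by_contra hne
    exact not_le_of_gt hN (le_radical hne)
  · exact ((hN.le_iff.mp (le_radical hN.1)).resolve_left h).symm

variable {M' : Type*} [AddCommGroup M'] [Module R M'] [Nontrivial M']

/-- The kernel of `f` is proper, hence lies in the radical. The correspondence between submodules of
`M'` and submodules containing the kernel then matches the two sums of proper submodules. -/
lemma comap_radical_of_surjective (h : radical R M ≠ ⊤) {f : M →ₗ[R] M'}
    (hf : Function.Surjective f) : (radical R M').comap f = radical R M := by
  have hker : LinearMap.ker f ≤ radical R M := by
    refine le_radical fun htop ↦ ?_
    obtain ⟨x, hx⟩ := exists_ne (0 : M')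
    obtain ⟨y, rfl⟩ := hf x
    exact hx (LinearMap.mem_ker.mp (htop ▸ Submodule.mem_top))
  have hcm : ((radical R M).map f).comap f = radical R M := by
    rw [Submodule.comap_map_eq, sup_eq_left.mpr hker]
  apply le_antisymm
  · rw [← hcm]
    refine Submodule.comap_mono (sSup_le fun N hN ↦ ?_)
    rw [← Submodule.map_comap_eq_of_surjective hf N]
    refine Submodule.map_mono (le_radical fun htop ↦ hN ?_)
    rw [← Submodule.map_comap_eq_of_surjective hf N, htop, Submodule.map_top,
      LinearMap.range_eq_top.mpr hf]
  · rw [← Submodule.map_le_iff_le_comap]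
    refine le_radical fun htop ↦ h ?_
    rw [← hcm, htop, Submodule.comap_top]

/-- The nonzero quotients of a module with a unique irreducible quotient have the same unique
irreducible quotient. -/
lemma radical_ne_top_of_surjective (h : radical R M ≠ ⊤) {f : M →ₗ[R] M'}
    (hf : Function.Surjective f) : radical R M' ≠ ⊤ := by
  intro htop
  have := comap_radical_of_surjective h hf
  rw [htop, Submodule.comap_top] at this
  exact h this.symm

lemma nonempty_irreducibleQuotient_equiv (h : radical R M ≠ ⊤) {f : M →ₗ[R] M'}
    (hf : Function.Surjective f) :
    Nonempty (IrreducibleQuotient R M ≃ₗ[R] IrreducibleQuotient R M') := by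
  let g : M →ₗ[R] IrreducibleQuotient R M' := (radical R M').mkQ ∘ₗ f
  have hg : Function.Surjective g := (Submodule.mkQ_surjective _).comp hf
  have hk : radical R M = LinearMap.ker g := by
    rw [LinearMap.ker_comp, Submodule.ker_mkQ, comap_radical_of_surjective h hf]
  exact ⟨(Submodule.quotEquivOfEq _ _ hk).trans (g.quotKerEquivOfSurjective hg)⟩

end Radical

/-! ### Eigenvalues and proper submodules. -/

section Weights

variable {K : Type*} [Field K] {A : Type*} [Ring A] [Algebra K A]
variable {M : Type*} [AddCommGroup M] [Module K M] [Module A M] [IsScalarTower K A M]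

lemma aeval_smul_of_mem_eigenspace {h : A} {μ : K} {w : M}
    (hw : w ∈ Module.End.eigenspace (Algebra.lsmul K K M h) μ) (p : Polynomial K) :
    Polynomial.aeval h p • w = p.eval μ • w := by
  rw [Module.End.mem_eigenspace_iff] at hw
  change h • w = μ • w at hw
  induction p using Polynomial.induction_on with
  | C a => simp
  | add p q hp hq => simp [add_smul, hp, hq]
  | monomial n a ih =>
    have e : Polynomial.aeval h (Polynomial.C a * Polynomial.X ^ (n + 1)) =
        Polynomial.aeval h (Polynomial.C a * Polynomial.X ^ n) * h := by
      simp [pow_succ, mul_assoc]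
    rw [e, mul_smul, hw, smul_algebra_smul_comm, ih, smul_smul]
    congr 1
    simp [pow_succ]
    ring

/-- An element of the sum of the eigenspaces for the eigenvalues `≠ μ` is killed by a polynomial in
the operator which is invertible on the eigenspace for `μ`. -/
lemma exists_polynomial_of_mem_iSup {h : A} {μ : K} {w : M}
    (hw : w ∈ ⨆ ν ∈ {ν : K | ν ≠ μ}, Module.End.eigenspace (Algebra.lsmul K K M h) ν) :
    ∃ p : Polynomial K, p.eval μ ≠ 0 ∧ Polynomial.aeval h p • w = 0 := by
  rw [iSup_subtype'] at hw
  induction hw using Submodule.iSup_induction' with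
  | zero => exact ⟨1, by simp, by simp⟩
  | mem ν w hw =>
    refine ⟨Polynomial.X - Polynomial.C ν.1, ?_, ?_⟩
    · simpa [sub_eq_zero] using Ne.symm ν.2
    · rw [aeval_smul_of_mem_eigenspace hw]
      simp
  | add w w' _ _ hw hw' =>
    obtain ⟨p, hp, hpw⟩ := hw
    obtain ⟨q, hq, hqw⟩ := hw'
    refine ⟨p * q, by simp [hp, hq], ?_⟩
    have e : Polynomial.aeval h (p * q) • w = 0 := by
      rw [mul_comm, map_mul, mul_smul, hpw, smul_zero]
    rw [smul_add, e, map_mul, mul_smul, hqw, smul_zero, add_zero]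

/-- If a module is generated by an eigenvector of `h`, whose eigenvalue has multiplicity one, then the
proper submodules lie in the sum of the other eigenspaces, so that their sum is proper. -/
theorem radical_ne_top_of_eigenspaces {h : A} {μ : K} {v : M} (hv0 : v ≠ 0)
    (hgen : ∀ m : M, ∃ a : A, a • v = m)
    (hv : v ∈ Module.End.eigenspace (Algebra.lsmul K K M h) μ)
    (hspan : ∀ m : M, ∃ c : K, m - c • v ∈
      ⨆ ν ∈ {ν : K | ν ≠ μ}, Module.End.eigenspace (Algebra.lsmul K K M h) ν) :
    radical A M ≠ ⊤ := by
  set E := ⨆ ν ∈ {ν : K | ν ≠ μ}, Module.End.eigenspace (Algebra.lsmul K K M h) ν with hE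
  have hvE : v ∉ E := fun hmem ↦ by
    obtain ⟨p, hp, hpv⟩ := exists_polynomial_of_mem_iSup hmem
    rw [aeval_smul_of_mem_eigenspace hv] at hpv
    exact (smul_ne_zero hp hv0) hpv
  -- If the coefficient of `v` in `w` were nonzero, a polynomial in `h` killing the part in `E`
  -- would turn `w` into a nonzero multiple of `v`, and `N` would be everything.
  have hN (N : Submodule A M) (hN : N ≠ ⊤) (w : M) (hw : w ∈ N) : w ∈ E := by
    obtain ⟨c, hc⟩ := hspan w
    by_cases hc0 : c = 0
    · simpa [hc0] using hc
    obtain ⟨p, hp, hpw⟩ := exists_polynomial_of_mem_iSup hc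
    rw [smul_sub, sub_eq_zero, smul_algebra_smul_comm, aeval_smul_of_mem_eigenspace hv,
      smul_smul] at hpw
    have hmem : (c * p.eval μ) • v ∈ N := hpw ▸ N.smul_mem _ hw
    have hvN : v ∈ N := by
      have := N.smul_mem (algebraMap K A (c * p.eval μ)⁻¹) hmem
      rwa [algebraMap_smul, inv_smul_smul₀ (mul_ne_zero hc0 hp)] at this
    refine absurd (Submodule.eq_top_iff'.mpr fun m ↦ ?_) hN
    obtain ⟨a, rfl⟩ := hgen m
    exact N.smul_mem a hvN
  have hrad : ∀ x ∈ radical A M, x ∈ E := fun x hx ↦ by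
    rw [radical, sSup_eq_iSup'] at hx
    induction hx using Submodule.iSup_induction' with
    | zero => exact zero_mem _
    | mem N w hw => exact hN N N.2 w hw
    | add x y _ _ hx hy => exact add_mem hx hy
  exact fun htop ↦ hvE (hrad v (htop ▸ Submodule.mem_top))

end Weights

end DoubleAffine

/-! ### Coefficients of roots and dominance of the highest root. -/

namespace RootPairing.Base

variable {ι K M N : Type*} [Field K] [CharZero K] [AddCommGroup M] [Module K M]
  [AddCommGroup N] [Module K N] {P : RootPairing ι K M N} (b : P.Base)

/-- The coefficient of a simple root in a root. -/
def coeff (α : ι) (i : b.support) : ℤ :=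
  b.toWeightBasisInt.repr (P.rootSpanMem ℤ α) i

lemma root_eq_sum_coeff (α : ι) : P.root α = ∑ i, b.coeff α i • P.root i := by
  have h := congrArg Subtype.val (b.toWeightBasisInt.sum_repr (P.rootSpanMem ℤ α))
  simpa [coeff] using h.symm

lemma repr_root_eq_coeff [P.IsRootSystem] (α : ι) (i : b.support) :
    b.toWeightBasis.repr (P.root α) i = b.coeff α i := by
  classical
  conv_lhs => rw [root_eq_sum_coeff b α]
  simp [Finsupp.single_apply]

lemma coeff_add {α β γ : ι} (h : P.root γ = P.root α + P.root β) :
    b.coeff γ = b.coeff α + b.coeff β := by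
  have e : P.rootSpanMem ℤ γ = P.rootSpanMem ℤ α + P.rootSpanMem ℤ β := Subtype.ext h
  ext i
  simp only [coeff, e, map_add, Finsupp.add_apply, Pi.add_apply]

lemma coeff_sub {α β γ : ι} (h : P.root γ = P.root α - P.root β) :
    b.coeff γ = b.coeff α - b.coeff β := by
  have e : P.rootSpanMem ℤ γ = P.rootSpanMem ℤ α - P.rootSpanMem ℤ β := Subtype.ext h
  ext i
  simp only [coeff, e, map_sub, Finsupp.sub_apply, Pi.sub_apply]

lemma coeff_neg {α β : ι} (h : P.root β = -P.root α) : b.coeff β = -b.coeff α := by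
  have e : P.rootSpanMem ℤ β = -P.rootSpanMem ℤ α := Subtype.ext h
  ext i
  simp only [coeff, e, map_neg, Finsupp.neg_apply, Pi.neg_apply]

lemma coeff_simple [DecidableEq b.support] (j : b.support) : b.coeff j = Pi.single j 1 := by
  ext i
  have e : P.rootSpanMem ℤ j = b.toWeightBasisInt j := Subtype.ext (by simp)
  simp [coeff, e, Finsupp.single_apply, Pi.single_apply, eq_comm]

lemma height_eq_sum_coeff (α : ι) : b.height α = ∑ i, b.coeff α i := by
  classical
  let f : ι → ℤ := fun i ↦ if h : i ∈ b.support then b.coeff α ⟨i, h⟩ else 0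
  have hf (i : b.support) : f i = b.coeff α i := by simp [f]
  have h : P.root α = ∑ j ∈ b.support, f j • P.root j := by
    rw [root_eq_sum_coeff b α, ← Finset.sum_coe_sort b.support]
    simp [hf]
  rw [height_eq_sum h, ← Finset.sum_coe_sort b.support]
  simp [hf]

lemma coeff_nonneg_or_nonpos [P.IsRootSystem] (α : ι) : 0 ≤ b.coeff α ∨ b.coeff α ≤ 0 := by
  obtain ⟨f, -, hf⟩ := b.exists_root_eq_sum_nat_or_neg α
  have key (g : ι → ℤ) (h : P.root α = ∑ j ∈ b.support, g j • P.root j) (i : b.support) :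
      b.coeff α i = g i := by
    classical
    have := congrArg (fun x ↦ b.toWeightBasis.repr x i) h
    rw [← Finset.sum_coe_sort b.support] at this
    simp only [repr_root_eq_coeff] at this
    simpa [Finsupp.single_apply] using this
  rcases hf with hf | hf
  · left
    intro i
    rw [key (fun j ↦ f j) (by simpa using hf)]
    simp
  · right
    intro i
    rw [key (fun j ↦ -f j) (by simpa using hf)]
    simp

lemma pairingIn_eq_sum_coeff [P.IsCrystallographic] (α β : ι) :
    P.pairingIn ℤ α β = ∑ i, b.coeff α i * P.pairingIn ℤ i β := by
  have h : (P.pairingIn ℤ α β : K) = (∑ i, b.coeff α i * P.pairingIn ℤ i β : ℤ) := by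
    push_cast
    have e (γ : ι) : (P.pairingIn ℤ γ β : K) = P.toLinearMap (P.root γ) (P.coroot β) := by
      rw [P.root_coroot_eq_pairing, ← P.algebraMap_pairingIn ℤ]
      simp
    simp only [e]
    conv_lhs => rw [root_eq_sum_coeff b α]
    simp [LinearMap.sum_apply]
  exact_mod_cast h

/-- The height of `μ` is maximal among the roots whose coefficients are at least those of `μ`. -/
def IsMaximalRoot (μ : ι) : Prop := ∀ ν, b.coeff μ ≤ b.coeff ν → b.height ν ≤ b.height μ

variable {b} [P.IsRootSystem]

/-- Otherwise `-μ` has coefficients at least those of `μ`, so its height is not larger; as `μ` has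
height at most zero, the height would be zero. -/
lemma IsMaximalRoot.coeff_nonneg {μ : ι} (hμ : b.IsMaximalRoot μ) : 0 ≤ b.coeff μ := by
  refine (b.coeff_nonneg_or_nonpos μ).resolve_right fun h ↦ ?_
  obtain ⟨ν, hν⟩ := P.neg_root_mem μ
  have e := b.coeff_neg hν
  have h1 := hμ ν (e ▸ h.trans (neg_nonneg.mpr h))
  have h2 : b.height μ ≤ 0 := by
    rw [height_eq_sum_coeff]
    exact Finset.sum_nonpos fun i _ ↦ h i
  have h3 : b.height ν = -b.height μ := by
    simp [height_eq_sum_coeff, e]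
  have := b.height_ne_zero μ
  omega

variable [Finite ι] [P.IsCrystallographic]

/-- A negative pairing would make `μ + αⱼ` a root of larger height. -/
lemma IsMaximalRoot.pairingIn_nonneg {μ : ι} (hμ : b.IsMaximalRoot μ) (j : b.support) :
    0 ≤ P.pairingIn ℤ μ j := by
  classical
  by_contra! h
  have hne : P.root μ ≠ -P.root j := fun e ↦ by
    have h1 := hμ.coeff_nonneg j
    rw [b.coeff_neg e, coeff_simple] at h1
    simp at h1
  obtain ⟨ν, hν⟩ := P.root_add_root_mem_of_pairingIn_neg h hne
  have e := b.coeff_add hν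
  have h1 := hμ ν (by rw [e, coeff_simple]; simp)
  rw [b.height_add hν, b.height_one_of_mem_support j.2] at h1
  omega

/-- Positivity spreads along the connected Dynkin diagram: if `j` is a neighbour of `i` with
coefficient zero, all terms of the pairing of `μ` with `αⱼ^∨` are nonpositive and the one of `i` is
negative, against dominance. -/
lemma IsMaximalRoot.one_le_coeff [P.IsReduced] [P.IsIrreducible] {μ : ι} (hμ : b.IsMaximalRoot μ)
    (i : b.support) : 1 ≤ b.coeff μ i := by
  obtain ⟨j, hj⟩ : ∃ j, 1 ≤ b.coeff μ j := by
    by_contra! h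
    refine P.ne_zero μ ?_
    rw [root_eq_sum_coeff b μ]
    refine Finset.sum_eq_zero fun i _ ↦ ?_
    have := hμ.coeff_nonneg i
    have h' := h i
    rw [show b.coeff μ i = 0 by simp only [Pi.zero_apply] at this; omega, zero_smul]
  refine b.induction_on_cartanMatrix (fun i ↦ 1 ≤ b.coeff μ i) hj fun i j hi hij ↦ ?_
  by_contra! h
  have hj0 : b.coeff μ j = 0 := by
    have := hμ.coeff_nonneg j
    simp only [Pi.zero_apply] at this
    omega
  have hne : i ≠ j := fun e ↦ by
    rw [e] at hi
    omega
  have hle (k : b.support) : b.coeff μ k * P.pairingIn ℤ k j ≤ 0 := by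
    by_cases hk : k = j
    · rw [hk, hj0, zero_mul]
    · exact mul_nonpos_of_nonneg_of_nonpos (hμ.coeff_nonneg k)
        (b.cartanMatrix_le_zero_of_ne k j hk)
  have hlt : b.coeff μ i * P.pairingIn ℤ i j < 0 := by
    refine mul_neg_of_pos_of_neg (by omega) (lt_of_le_of_ne (b.cartanMatrix_le_zero_of_ne i j hne) ?_)
    rwa [Ne, cartanMatrix_apply_eq_zero_iff_symm] at hij
  have h1 := hμ.pairingIn_nonneg j
  rw [b.pairingIn_eq_sum_coeff] at h1
  have h2 : ∑ k, b.coeff μ k * P.pairingIn ℤ k j < 0 :=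
    Finset.sum_neg' (fun k _ ↦ hle k) ⟨i, Finset.mem_univ i, hlt⟩
  omega

/-- Full support and dominance make the pairing of `μ` and `θ` positive, so `μ - θ` would be a root
if `μ ≠ θ`. Its coefficients have one sign, hence one of the two roots dominates the other and is
strictly higher. -/
lemma IsMaximalRoot.eq [P.IsReduced] [P.IsIrreducible] {μ θ : ι} (hμ : b.IsMaximalRoot μ)
    (hθ : b.IsMaximalRoot θ) : μ = θ := by
  have hnonneg (i : b.support) : 0 ≤ P.pairingIn ℤ i θ := by
    have := hθ.pairingIn_nonneg i
    contrapose! this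
    exact (P.pairingIn_lt_zero_iff ℤ).mp this
  obtain ⟨i, hi⟩ : ∃ i : b.support, 0 < P.pairingIn ℤ i θ := by
    by_contra! h
    have h1 := b.pairingIn_eq_sum_coeff θ θ
    rw [Finset.sum_eq_zero fun i _ ↦ by rw [le_antisymm (h i) (hnonneg i), mul_zero],
      P.pairingIn_same] at h1
    omega
  have hpos : 0 < P.pairingIn ℤ μ θ := by
    rw [b.pairingIn_eq_sum_coeff]
    exact Finset.sum_pos' (fun k _ ↦ mul_nonneg (hμ.coeff_nonneg k) (hnonneg k))
      ⟨i, Finset.mem_univ i, mul_pos (by have := hμ.one_le_coeff i; omega) hi⟩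
  by_contra hne
  obtain ⟨ν, hν⟩ := P.root_sub_root_mem_of_pairingIn_pos hpos hne
  have e := b.coeff_sub hν
  have h0 := b.height_ne_zero ν
  have hh := b.height_sub hν
  rcases b.coeff_nonneg_or_nonpos ν with h | h
  · have h1 := hθ μ (by rwa [e, sub_nonneg] at h)
    have h2 : 0 ≤ b.height ν := by
      rw [height_eq_sum_coeff]
      exact Finset.sum_nonneg fun i _ ↦ h i
    omega
  · have h1 := hμ θ (by rwa [e, sub_nonpos] at h)
    have h2 : b.height ν ≤ 0 := by
      rw [height_eq_sum_coeff]
      exact Finset.sum_nonpos fun i _ ↦ h i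
    omega

/-- A root of maximal height has the largest coefficients of all roots. -/
theorem coeff_le_of_forall_height_le [P.IsReduced] [P.IsIrreducible] {θ : ι}
    (hθ : ∀ α, b.height α ≤ b.height θ) (α : ι) : b.coeff α ≤ b.coeff θ := by
  -- Among the roots dominating `α`, one of largest height satisfies `IsMaximalRoot`, and there is
  -- only one such root.
  obtain ⟨μ, hμ, hmax⟩ := Set.exists_max_image {ν | b.coeff α ≤ b.coeff ν} b.height
    (Set.toFinite _) ⟨α, le_refl (b.coeff α)⟩
  have h1 : b.IsMaximalRoot μ := fun ν hν ↦ hmax ν (le_trans hμ hν)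
  exact h1.eq (fun ν _ ↦ hθ ν : b.IsMaximalRoot θ) ▸ hμ

theorem one_le_coeff_of_forall_height_le [P.IsReduced] [P.IsIrreducible] {θ : ι}
    (hθ : ∀ α, b.height α ≤ b.height θ) (i : b.support) : 1 ≤ b.coeff θ i :=
  IsMaximalRoot.one_le_coeff (fun ν _ ↦ hθ ν) i

end RootPairing.Base

namespace DoubleAffine

/-! ### The root space decomposition of `𝔗`. -/

section WeightSpaces

open LieAlgebra LieAlgebra.IsKilling

variable {𝔤 : Type*} [LieRing 𝔤] [LieAlgebra ℂ 𝔤]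

lemma Loop.ext_coeff {x y : Loop 𝔤} (h : ∀ m, Loop.coeff m x = Loop.coeff m y) : x = y := by
  by_contra hne
  obtain ⟨m, hm⟩ := Loop.exists_coeff_ne (sub_ne_zero.mpr hne)
  rw [map_sub, h, sub_self] at hm
  exact hm rfl

variable [Module.Finite ℂ 𝔤] [LieAlgebra.IsSimple ℂ 𝔤]
variable {H : LieSubalgebra ℂ 𝔤} [H.IsCartanSubalgebra]
variable {b : (rootSystem H).Base}

lemma cartanIncl_injective : Function.Injective (cartanIncl b) := by
  intro h k e
  have h1 := congrArg (fun z : 𝔗 b ↦ Loop.coeff 0 z.loop) e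
  have h2 := congrArg DoubleAffine.c e
  have h3 := congrArg DoubleAffine.d e
  simp only [cartanIncl, LinearMap.coe_mk, AddHom.coe_mk, Loop.coeff_single, if_true] at h1 h2 h3
  exact Prod.ext (Subtype.ext h1) (Prod.ext h2 h3)

lemma lie_cartanIncl (h k : Cartan H) : ⁅cartanIncl b h, cartanIncl b k⁆ = 0 := by
  have e : ⁅(h.1 : 𝔤), (k.1 : 𝔤)⁆ = 0 := by
    rw [← LieSubalgebra.coe_bracket, trivial_lie_zero]
    rfl
  ext1
  · simp [cartanIncl, Loop.single_lie, e, eulerSum_single_zero]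
  · ext i
    simp [cartanIncl, cocycle_single_zero]
  · simp

lemma coeff_of_mem_rootSpace {β : Module.Dual ℂ (Cartan H)} {x : 𝔗 b} (hx : x ∈ rootSpace b β)
    (h : Cartan H) (m : Fin 2 → ℤ) : ⁅(h.1 : 𝔤), Loop.coeff m x.loop⁆ +
      (h.2.2 0 * m 0 + h.2.2 1 * m 1) • Loop.coeff m x.loop = β h • Loop.coeff m x.loop := by
  have := congrArg (fun z : 𝔗 b ↦ Loop.coeff m z.loop) (hx h)
  simpa [cartanIncl, eulerSum_single_zero, Loop.coeff_lie, Loop.coeff_eulerSum] using this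

/-- The derivations `d₁, d₂` exclude nonzero degrees, and in degree zero the Cartan subalgebra is
its own zero root space. -/
lemma exists_cartanIncl_eq {x : 𝔗 b} (hx : x ∈ rootSpace b 0) : ∃ h, cartanIncl b h = x := by
  have hcoeff (m : Fin 2 → ℤ) (hm : m ≠ 0) : Loop.coeff m x.loop = 0 := by
    obtain ⟨i, hi⟩ := Function.ne_iff.mp hm
    have := coeff_of_mem_rootSpace hx (0, 0, Pi.single i 1) m
    by_contra h0
    fin_cases i <;> simp_all
  have hmem : Loop.coeff 0 x.loop ∈ H := by
    have h0 : Loop.coeff 0 x.loop ∈ LieAlgebra.rootSpace H (0 : H → ℂ) := by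
      refine LieModule.weightSpace_le_genWeightSpace 𝔤 _ ?_
      rw [LieModule.mem_weightSpace]
      intro k
      simpa using coeff_of_mem_rootSpace hx (k, 0, 0) 0
    rwa [rootSpace_zero_eq, LieSubalgebra.mem_toLieSubmodule] at h0
  refine ⟨(⟨_, hmem⟩, x.c, x.d), ?_⟩
  ext1
  · refine Loop.ext_coeff fun m ↦ ?_
    simp only [cartanIncl, LinearMap.coe_mk, AddHom.coe_mk, Loop.coeff_single]
    split_ifs with hm
    · rw [hm]
    · rw [hcoeff m (Ne.symm hm)]
  · rfl
  · rfl

/-- The root vectors of `𝔗` are the `y(m)` with `y` a weight vector of `𝔤`. -/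
lemma exists_weight_of_mem_rootSpace {β : Module.Dual ℂ (Cartan H)} (hβ : β ≠ 0) {x : 𝔗 b}
    (hx : x ∈ rootSpace b β) (hx0 : x ≠ 0) :
    ∃ (χ : LieModule.Weight ℂ H 𝔤) (m : Fin 2 → ℤ) (y : 𝔤), y ∈ LieAlgebra.rootSpace H χ ∧
      x = { loop := Loop.single m y, c := 0, d := 0 } ∧
      ∀ h : Cartan H, β h = χ h.1 + (h.2.2 0 * m 0 + h.2.2 1 * m 1) := by
  obtain ⟨k, hk⟩ : ∃ k, β k ≠ 0 := by
    by_contra! h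
    exact hβ (LinearMap.ext h)
  have hd : x.d = 0 := by
    have := congrArg DoubleAffine.d (hx k)
    simpa [hk] using this.symm
  have hc : x.c = 0 := by
    have := congrArg DoubleAffine.c (hx k)
    have h2 : (0 : Fin 2 → ℂ) = β k • x.c := by
      rw [← c_smul, ← this]
      ext i
      simp [cartanIncl, cocycle_single_zero]
    simpa [hk] using h2.symm
  have hl : x.loop ≠ 0 := fun hl ↦ hx0 (DoubleAffine.ext hl hc hd)
  obtain ⟨m, hm⟩ := Loop.exists_coeff_ne hl
  have hβd (n : Fin 2 → ℤ) (hn : Loop.coeff n x.loop ≠ 0) (d : Fin 2 → ℂ) :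
      d 0 * n 0 + d 1 * n 1 = β (0, 0, d) := by
    have := coeff_of_mem_rootSpace hx (0, 0, d) n
    refine smul_left_injective ℂ hn ?_
    simpa using this
  -- The eigenvalues of `d₁` and `d₂` determine the degree, so the loop part is homogeneous.
  have huniq (n : Fin 2 → ℤ) (hn : Loop.coeff n x.loop ≠ 0) : m = n := by
    have key (d : Fin 2 → ℂ) : d 0 * m 0 + d 1 * m 1 = d 0 * n 0 + d 1 * n 1 :=
      (hβd m hm d).trans (hβd n hn d).symm
    ext i
    have := key (Pi.single i 1)
    fin_cases i <;> simpa using this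
  let y := Loop.coeff m x.loop
  have hχ (k : H) : ⁅(k : 𝔤), y⁆ = β (k, 0, 0) • y := by
    simpa using coeff_of_mem_rootSpace hx (k, 0, 0) m
  have hmem : y ∈ LieAlgebra.rootSpace H fun k ↦ β (k, 0, 0) :=
    LieModule.weightSpace_le_genWeightSpace 𝔤 _ <| by
      rw [LieModule.mem_weightSpace]
      exact hχ
  refine ⟨⟨fun k ↦ β (k, 0, 0), fun e ↦ hm ((LieSubmodule.mem_bot y).mp (e.le hmem))⟩, m, y, hmem,
    DoubleAffine.ext (Loop.ext_coeff fun n ↦ ?_) hc hd, fun h ↦ ?_⟩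
  · rw [Loop.coeff_single]
    split_ifs with e
    · rw [← e]
    · by_contra hn
      exact e (huniq n hn)
  · have := coeff_of_mem_rootSpace hx h m
    refine smul_left_injective ℂ hm ?_
    change β h • y = _
    rw [← this]
    change ⁅(h.1 : 𝔤), y⁆ + _ = _
    rw [hχ]
    simp only [y]
    change _ = (β (h.1, 0, 0) + _) • _
    module

variable (b)

lemma iSup_rootSpace_eq_top : ⨆ β, rootSpace b β = ⊤ := by
  refine Submodule.eq_top_iff'.mpr fun x ↦ ?_
  have hloop (a : Loop 𝔤) :
      ({ loop := a, c := 0, d := 0 } : 𝔗 b) ∈ ⨆ β, rootSpace b β := by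
    let incl : Loop 𝔤 →ₗ[ℂ] 𝔗 b :=
      { toFun := fun a ↦ { loop := a, c := 0, d := 0 }
        map_add' := fun x y ↦ by ext1 <;> simp
        map_smul' := fun c x ↦ by ext1 <;> simp }
    change incl a ∈ ⨆ β, rootSpace b β
    induction a using Loop.induction with
    | h0 => simp
    | hadd a a' h h' => rw [map_add]; exact add_mem h h'
    | h m y =>
      have hy : y ∈ (⨆ χ : LieModule.Weight ℂ H 𝔤, LieModule.genWeightSpace 𝔤 χ).toSubmodule := by
        rw [LieModule.iSup_genWeightSpace_eq_top' ℂ H 𝔤]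
        exact Submodule.mem_top
      rw [LieSubmodule.iSup_toSubmodule] at hy
      induction hy using Submodule.iSup_induction' with
      | zero => simp
      | add y z _ _ hy hz => rw [map_add, map_add]; exact add_mem hy hz
      | mem χ y hy =>
        refine Submodule.mem_iSup_of_mem
          (χ.toLinear ∘ₗ LinearMap.fst ℂ _ _ + ((m 0 : ℂ) • delta 0 + (m 1 : ℂ) • delta 1)) ?_
        refine single_mem_rootSpace m y fun h ↦ ?_
        have e : ⁅(h.1 : 𝔤), y⁆ = χ h.1 • y := lie_eq_smul_of_mem_rootSpace hy h.1
        rw [e]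
        simp only [delta, LinearMap.add_apply, LinearMap.comp_apply, LinearMap.fst_apply,
          LinearMap.smul_apply, LinearMap.snd_apply, LinearMap.proj_apply, smul_eq_mul,
          LieModule.Weight.toLinear_apply]
        module
  have e : x = { loop := x.loop, c := 0, d := 0 } + cartanIncl b (0, x.c, x.d) := by
    ext1 <;> simp [cartanIncl]
  rw [e]
  refine add_mem (hloop _) (Submodule.mem_iSup_of_mem 0 fun h ↦ ?_)
  rw [lie_cartanIncl, LinearMap.zero_apply, zero_smul]

/-- The root spaces lie in the simultaneous generalized eigenspaces of a commuting family, and these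
are independent. -/
lemma iSupIndep_rootSpace : iSupIndep (rootSpace b) := by
  let f : Cartan H → Module.End ℂ (𝔗 b) := fun h ↦ LieAlgebra.ad ℂ (𝔗 b) (cartanIncl b h)
  have hcomm (h k : Cartan H) : Commute (f h) (f k) := by
    refine LinearMap.ext fun x ↦ ?_
    have e := leibniz_lie (cartanIncl b h) (cartanIncl b k) x
    rw [lie_cartanIncl, zero_lie, zero_add] at e
    exact e
  have hind := (Module.End.independent_iInf_maxGenEigenspace_of_forall_mapsTo f fun h k μ ↦
    Module.End.mapsTo_maxGenEigenspace_of_comm (hcomm k h) μ).comp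
      (f := fun β : Module.Dual ℂ (Cartan H) ↦ (β : Cartan H → ℂ)) DFunLike.coe_injective
  refine hind.mono fun β x hx ↦ ?_
  simp only [Function.comp_apply, Submodule.mem_iInf]
  intro h
  refine Module.End.eigenspace_le_maxGenEigenspace (f := f h) (μ := β h) ?_
  rw [Module.End.mem_eigenspace_iff]
  exact hx h

end WeightSpaces

end DoubleAffine

namespace DoubleAffine

/-! ### Signs of the coefficients of affine roots; inclusions of root sets. -/

section Coefficients

open LieAlgebra LieAlgebra.IsKilling

variable {𝔤 : Type*} [LieRing 𝔤] [LieAlgebra ℂ 𝔤] [Module.Finite ℂ 𝔤] [LieAlgebra.IsSimple ℂ 𝔤]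
variable {H : LieSubalgebra ℂ 𝔤} [H.IsCartanSubalgebra]
variable (b : (rootSystem H).Base)

lemma height_le_highestRoot (α : H.root) : b.height α ≤ b.height (highestRoot b) :=
  (exists_highest b).choose_spec α

lemma mark_eq_coeff (i : b.support) : mark b i = b.coeff (highestRoot b) i :=
  b.repr_root_eq_coeff _ i

/-- The element `αᵢ^* - kᵢ α₋₁^*` (with `k₀ = 0`) of `𝔥̂`. -/
def affineCoweight : Index b → Cartan H
  | none => dualSimple b none
  | some i => dualSimple b (some i) - mark b i • dualSimpleNegOne H

open scoped Classical in
-- The summands have no `d₂` component, so they see a root only modulo `δ₂`: each reads off one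
-- coefficient.
lemma fA_eq_sum (A : Finset (Index b)) :
    fA b A = ∑ i with i ∉ A, affineCoweight b i := by
  rw [fA, Finset.sum_filter, Finset.sum_filter, Finset.sum_filter, Fintype.sum_option,
    Fintype.sum_option, Finset.sum_smul, add_sub_assoc, ← Finset.sum_sub_distrib]
  congr 1
  refine Finset.sum_congr rfl fun i _ ↦ ?_
  split_ifs <;> simp [affineCoweight]

/-- Facts about `φ` thereby become the case `𝒜 = ∅` of facts about `f_𝒜`. -/
lemma phi_eq_fA : phi b = fA b ∅ := by
  classical
  simp [phi, fA]

/-- The weights of `𝔤` are integral combinations of the simple roots, whose coefficients have the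
same sign and are bounded by those of the highest root. -/
lemma exists_int_coeff_weight (χ : LieModule.Weight ℂ H 𝔤) :
    ∃ c : b.support → ℤ, (∀ i, χ (coweight b i) = c i) ∧ (0 ≤ c ∨ c ≤ 0) ∧
      (∀ i, -b.coeff (highestRoot b) i ≤ c i ∧ c i ≤ b.coeff (highestRoot b) i) ∧
      (c = 0 → ∀ h, χ h = 0) ∧ χ.toLinear = ∑ i, (c i : ℂ) • (rootSystem H).root i := by
  by_cases hχ : χ.IsZero
  · have h0 (h : H) : χ h = 0 := by
      rw [show (χ : H → ℂ) = 0 from hχ]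
      rfl
    refine ⟨0, fun i ↦ by simp [h0], Or.inl le_rfl, fun i ↦ ?_, fun _ ↦ h0, ?_⟩
    · have := RootPairing.Base.one_le_coeff_of_forall_height_le (height_le_highestRoot b) i
      simp only [Pi.zero_apply]
      omega
    · ext h
      simp [h0]
  · let γ : H.root := ⟨χ, by simpa using hχ⟩
    have hγ : (rootSystem H).root γ = χ.toLinear := rfl
    refine ⟨b.coeff γ, fun i ↦ ?_, b.coeff_nonneg_or_nonpos γ, fun i ↦ ⟨?_, ?_⟩, fun h ↦ ?_, ?_⟩
    · rw [← b.repr_root_eq_coeff, hγ, coweight, ← LieModule.Weight.toLinear_apply,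
        Module.apply_evalEquiv_symm_apply]
      rfl
    · obtain ⟨ν, hν⟩ := (rootSystem H).neg_root_mem γ
      have h1 : b.coeff ν i ≤ b.coeff (highestRoot b) i :=
        RootPairing.Base.coeff_le_of_forall_height_le (height_le_highestRoot b) ν i
      rw [b.coeff_neg hν, Pi.neg_apply] at h1
      omega
    · exact RootPairing.Base.coeff_le_of_forall_height_le (height_le_highestRoot b) γ i
    · refine absurd ?_ ((rootSystem H).ne_zero γ)
      rw [b.root_eq_sum_coeff, h]
      simp
    · rw [← hγ, b.root_eq_sum_coeff γ]
      exact Finset.sum_congr rfl fun i _ ↦ (Int.cast_smul_eq_zsmul ℂ _ _).symm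

variable {b}

/-- The roots of `𝔗` are, modulo `δ₂`, integral combinations of `α₀, …, αₛ` with coefficients of the
same sign. -/
lemma exists_int_coeff {β : Module.Dual ℂ (Cartan H)} (hβ : β ∈ roots b) :
    ∃ (c : Index b → ℤ) (n : ℤ), (∀ i, β (affineCoweight b i) = c i) ∧ (0 ≤ c ∨ c ≤ 0) ∧
      β (dualSimpleNegOne H) = n ∧ (c = 0 → β = n • delta 1) := by
  obtain ⟨x, hx, hx0⟩ := Submodule.exists_mem_ne_zero_of_ne_bot hβ.2
  obtain ⟨χ, m, y, -, -, h⟩ := exists_weight_of_mem_rootSpace hβ.1 hx hx0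
  obtain ⟨c, hc1, hc2, hc3, hc4, -⟩ := exists_int_coeff_weight b χ
  have hχ0 : χ 0 = 0 := by rw [← LieModule.Weight.toLinear_apply, map_zero]
  have hk (i : b.support) : 1 ≤ b.coeff (highestRoot b) i :=
    RootPairing.Base.one_le_coeff_of_forall_height_le (height_le_highestRoot b) i
  -- For `β = χ + m₁δ₁ + m₂δ₂`, writing `δ₁ = α₀ + θ` gives the coefficients `m₁` and `cᵢ + m₁kᵢ`.
  -- As `|cᵢ| ≤ kᵢ`, they have the sign of `m₁`, or that of `χ` if `m₁ = 0`.
  refine ⟨fun i ↦ i.elim (m 0) fun i ↦ c i + m 0 * b.coeff (highestRoot b) i, m 1, ?_, ?_, ?_, ?_⟩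
  · rintro (_ | i)
    · rw [h]
      simp [affineCoweight, dualSimple, hχ0]
    · rw [h]
      simp [affineCoweight, dualSimple, dualSimpleNegOne, hc1, mark_eq_coeff, mul_comm]
  · rcases lt_trichotomy (m 0) 0 with hm | hm | hm
    · refine Or.inr fun i ↦ ?_
      rcases i with _ | i
      · exact hm.le
      · have h1 := (hc3 i).2
        have h2 := hk i
        simp only [Option.elim, Pi.zero_apply]
        nlinarith
    · refine hc2.imp (fun h i ↦ ?_) (fun h i ↦ ?_)
      all_goals
        rcases i with _ | i
        · simp [hm]
        · simpa [hm] using h i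
    · refine Or.inl fun i ↦ ?_
      rcases i with _ | i
      · exact hm.le
      · have h1 := (hc3 i).1
        have h2 := hk i
        simp only [Option.elim, Pi.zero_apply]
        nlinarith
  · rw [h]
    simp [dualSimpleNegOne, hχ0]
  · intro h0
    have hm : m 0 = 0 := congrFun h0 none
    have hc : c = 0 := by
      ext i
      simpa [hm] using congrFun h0 (some i)
    refine LinearMap.ext fun k ↦ ?_
    rw [h, hc4 hc]
    simp [hm, delta, mul_comm]

open scoped Classical in
lemma apply_fA {β : Module.Dual ℂ (Cartan H)} {c : Index b → ℤ}
    (hc : ∀ i, β (affineCoweight b i) = c i) (A : Finset (Index b)) :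
    β (fA b A) = (∑ i with i ∉ A, c i : ℤ) := by
  rw [fA_eq_sum, map_sum, Int.cast_sum]
  exact Finset.sum_congr rfl fun i _ ↦ hc i

lemma apply_phi {β : Module.Dual ℂ (Cartan H)} {c : Index b → ℤ}
    (hc : ∀ i, β (affineCoweight b i) = c i) : β (phi b) = (∑ i, c i : ℤ) := by
  classical
  rw [phi_eq_fA, apply_fA hc]
  simp

/-- A nonzero multiple of `δ₂` is a root. -/
lemma smul_delta_mem_roots {n : ℤ} (hn : n ≠ 0) : n • delta 1 ∈ roots b := by
  have h0 : (n • delta 1 : Module.Dual ℂ (Cartan H)) (dualSimpleNegOne H) = n := by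
    simp [delta, dualSimpleNegOne]
  refine ⟨fun e ↦ ?_, fun e ↦ ?_⟩
  · rw [e, LinearMap.zero_apply] at h0
    exact hn (by exact_mod_cast h0.symm)
  · let γ := highestRoot b
    let h := (rootSystem H).coroot γ
    have hmem := single_mem_rootSpace (b := b) (β := n • delta 1) (Pi.single 1 n) (h : 𝔤) fun k ↦ by
      rw [← LieSubalgebra.coe_bracket, trivial_lie_zero]
      simp [delta, mul_comm]
    rw [e, Submodule.mem_bot] at hmem
    have := congrArg (fun z : 𝔗 b ↦ Loop.coeff (Pi.single 1 n) z.loop) hmem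
    have h1 : (h : 𝔤) = 0 := by simpa [Loop.coeff_single] using this
    exact (rootSystem H).flip.ne_zero γ (Subtype.ext h1)

lemma phi_smul_delta (n : ℤ) : (n • delta 1 : Module.Dual ℂ (Cartan H)) (phi b) = 0 := by
  rw [LinearMap.smul_apply, delta_phi, smul_zero]

lemma sum_eq_zero_iff_of_sign {ι : Type*} {s : Finset ι} {c : ι → ℤ} (h : 0 ≤ c ∨ c ≤ 0) :
    ∑ i ∈ s, c i = 0 ↔ ∀ i ∈ s, c i = 0 := by
  rcases h with h | h
  · exact Finset.sum_eq_zero_iff_of_nonneg fun i _ ↦ h i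
  · exact Finset.sum_eq_zero_iff_of_nonpos fun i _ ↦ h i

lemma setI_subset : setI b ⊆ phiPos b ∪ (phiZero H \ {0}) := by
  rintro β (hβ | ⟨n, hn, rfl⟩)
  · refine Or.inl ⟨Or.inl hβ, ?_⟩
    rintro ⟨n, -, rfl⟩
    have := hβ.2
    rw [LinearMap.smul_apply, delta_phi] at this
    simp at this
  · refine Or.inr ⟨⟨n, by simp⟩, ?_⟩
    have := (smul_delta_mem_roots (b := b) (n := n) (by exact_mod_cast hn.ne')).1
    simpa using this

/-- A positive total of coefficients of one sign makes them all nonnegative, so every partial sum is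
too; for multiples of `δ₂` they all vanish. -/
lemma phiPos_union_subset (A : Finset (Index b)) : phiPos b ∪ (phiZero H \ {0}) ⊆ setQ b A := by
  classical
  rintro β (hβ | ⟨⟨n, rfl⟩, hn⟩)
  · obtain ⟨h1, h2⟩ := phi_pos_of_mem b hβ
    obtain ⟨c, n, hc1, hc2, -, -⟩ := exists_int_coeff h1
    refine ⟨h1, ?_⟩
    have hc : 0 ≤ c := by
      refine hc2.resolve_right fun hc ↦ ?_
      rw [apply_phi hc1, Complex.intCast_re] at h2
      have : ∑ i, c i ≤ 0 := Finset.sum_nonpos fun i _ ↦ hc i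
      exact absurd (Int.cast_pos.mp h2) (not_lt.mpr this)
    rw [apply_fA hc1, Complex.intCast_re]
    exact Int.cast_nonneg (Finset.sum_nonneg fun i _ ↦ hc i)
  · have hn0 : n ≠ 0 := fun h ↦ hn (by simp [h])
    refine ⟨smul_delta_mem_roots hn0, ?_⟩
    obtain ⟨c, n', hc1, hc2, -, -⟩ := exists_int_coeff (smul_delta_mem_roots (b := b) hn0)
    have h0 := phi_smul_delta (b := b) n
    rw [apply_phi hc1] at h0
    have h1 := (sum_eq_zero_iff_of_sign hc2).mp (by exact_mod_cast h0 : ∑ i, c i = 0)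
    rw [apply_fA hc1, Finset.sum_eq_zero fun i _ ↦ h1 i (Finset.mem_univ i)]
    simp

/-- The case to check is that of nonpositive coefficients: a nonnegative sum over the complement of
`A'` makes them zero there, hence on the smaller complement of `A`. -/
lemma setQ_mono {A A' : Finset (Index b)} (h : A' ⊆ A) : setQ b A' ⊆ setQ b A := by
  classical
  rintro β ⟨hβ, h1⟩
  refine ⟨hβ, ?_⟩
  obtain ⟨c, n, hc1, hc2, -, -⟩ := exists_int_coeff hβ
  rw [apply_fA hc1, Complex.intCast_re, Int.cast_nonneg_iff] at h1 ⊢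
  rcases hc2 with hc | hc
  · exact Finset.sum_nonneg fun i _ ↦ hc i
  · have h2 := (sum_eq_zero_iff_of_sign (Or.inr hc)).mp
      (le_antisymm (Finset.sum_nonpos fun i _ ↦ hc i) h1)
    refine (Finset.sum_eq_zero fun i hi ↦ h2 i ?_).ge
    simp only [Finset.mem_filter, Finset.mem_univ, true_and] at hi ⊢
    exact fun hi' ↦ hi (h hi')

end Coefficients

end DoubleAffine

namespace DoubleAffine

/-! ### Brackets of opposite root spaces; splitting by the sign of `β(f)`. -/

section Triangular

open LieAlgebra LieAlgebra.IsKilling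

variable {𝔤 : Type*} [LieRing 𝔤] [LieAlgebra ℂ 𝔤] [Module.Finite ℂ 𝔤] [LieAlgebra.IsSimple ℂ 𝔤]
variable {H : LieSubalgebra ℂ 𝔤} [H.IsCartanSubalgebra]
variable {b : (rootSystem H).Base}

/-- Up to a scalar, the coroot is dual to the root under the Killing form. -/
lemma cartanEquivDual_symm_root (α : H.root) :
    (cartanEquivDual H).symm ((rootSystem H).root α) =
      ((rootSystem H).root α ((cartanEquivDual H).symm ((rootSystem H).root α)) / 2) •
        (rootSystem H).coroot α := by
  set t := (cartanEquivDual H).symm ((rootSystem H).root α)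
  have ht : (rootSystem H).root α t ≠ 0 :=
    root_apply_cartanEquivDual_symm_ne_zero (LieSubalgebra.isNonZero_coe_root α)
  have e : (rootSystem H).coroot α = (2 : ℂ) • ((rootSystem H).root α t)⁻¹ • t := by
    rw [rootSystem_coroot_apply, coroot, ← Nat.cast_smul_eq_nsmul ℂ]
    rfl
  rw [e, smul_smul, smul_smul]
  field_simp
  exact (one_smul ℂ t).symm

variable (b) in
/-- The ratio of the normalized form and of the Killing form. -/
def formRatio : ℂ := 2 / killingForm ℂ 𝔤 ((rootSystem H).coroot (highestRoot b))
  ((rootSystem H).coroot (highestRoot b))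

lemma normalizedForm_apply (x y : 𝔤) :
    (normalizedForm b).form x y = formRatio b * killingForm ℂ 𝔤 x y := rfl

/-- For the normalized form, the highest root corresponds to its coroot. -/
lemma formRatio_smul_coroot : formRatio b • (rootSystem H).coroot (highestRoot b) =
    (cartanEquivDual H).symm ((rootSystem H).root (highestRoot b)) := by
  rw [cartanEquivDual_symm_root]
  congr 1
  set θ := highestRoot b
  set t := (cartanEquivDual H).symm ((rootSystem H).root θ) with htdef
  have ht : (rootSystem H).root θ t ≠ 0 :=
    root_apply_cartanEquivDual_symm_ne_zero (LieSubalgebra.isNonZero_coe_root θ)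
  have h1 : killingForm ℂ 𝔤 ((rootSystem H).coroot θ) ((rootSystem H).coroot θ) =
      (2 : ℕ) • ((rootSystem H).root θ t)⁻¹ • (θ : LieModule.Weight ℂ H 𝔤) (coroot θ) :=
    traceForm_coroot (θ : LieModule.Weight ℂ H 𝔤) (coroot θ)
  rw [formRatio, h1, root_apply_coroot (LieSubalgebra.isNonZero_coe_root θ)]
  simp only [nsmul_eq_mul, smul_eq_mul, Nat.cast_ofNat]
  field_simp

/-- `λ` vanishes on `[𝔗_β, 𝔗_{-β}]` if `β` vanishes on `f_𝒜` and `λ` on `𝔥̂_𝒜 ⊕ ℂc₂`. -/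
lemma apply_eq_zero_of_lie {A : Finset (Index b)} {lam : Module.Dual ℂ (Cartan H)}
    (hlam : cartanA b A ≤ LinearMap.ker lam) {β : Module.Dual ℂ (Cartan H)}
    (hβ : β (fA b A) = 0) {x y : 𝔗 b} (hx : x ∈ rootSpace b β) (hy : y ∈ rootSpace b (-β))
    {h : Cartan H} (hh : cartanIncl b h = ⁅x, y⁆) : lam h = 0 := by
  classical
  suffices ⁅x, y⁆ ≠ 0 → lam h = 0 by
    by_contra hne
    refine hne (this fun h0 ↦ hne ?_)
    rw [cartanIncl_injective (hh.trans (h0.trans (map_zero _).symm)), map_zero]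
  intro hxy
  have hβ0 : β ≠ 0 := by
    rintro rfl
    rw [neg_zero] at hy
    obtain ⟨k, rfl⟩ := exists_cartanIncl_eq hx
    obtain ⟨l, rfl⟩ := exists_cartanIncl_eq hy
    exact hxy (lie_cartanIncl k l)
  have hx0 : x ≠ 0 := fun e ↦ hxy (by rw [e, zero_lie])
  have hy0 : y ≠ 0 := fun e ↦ hxy (by rw [e, lie_zero])
  obtain ⟨χ, m, x', hx', hxe, hχ⟩ := exists_weight_of_mem_rootSpace hβ0 hx hx0
  obtain ⟨χ', m', y', hy', hye, hχ'⟩ := exists_weight_of_mem_rootSpace (neg_ne_zero.mpr hβ0) hy hy0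
  have hzero (χ : LieModule.Weight ℂ H 𝔤) : χ 0 = 0 := by
    rw [← LieModule.Weight.toLinear_apply, map_zero]
  have hmm : m + m' = 0 := by
    have key (d : Fin 2 → ℂ) : d 0 * m' 0 + d 1 * m' 1 = -(d 0 * m 0 + d 1 * m 1) := by
      have := hχ' (0, 0, d)
      rw [LinearMap.neg_apply, hχ, hzero, hzero] at this
      simpa using this.symm
    ext i
    have := key (Pi.single i 1)
    fin_cases i
    · have : (m' 0 : ℂ) = -m 0 := by simpa using this
      have : m' 0 = -m 0 := by exact_mod_cast this
      simp [this]
    · have : (m' 1 : ℂ) = -m 1 := by simpa using this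
      have : m' 1 = -m 1 := by exact_mod_cast this
      simp [this]
  have hneg : (χ' : H → ℂ) = -χ := by
    ext k
    have := hχ' (k, 0, 0)
    rw [LinearMap.neg_apply, hχ] at this
    simpa using this.symm
  rw [hneg] at hy'
  have hbr := lie_eq_killingForm_smul_of_mem_rootSpace_of_mem_rootSpace_neg hx' hy'
  set κ := killingForm ℂ 𝔤 x' y' with hκ
  set t : Module.Dual ℂ H ≃ₗ[ℂ] H := (cartanEquivDual H).symm with ht
  -- The bracket has a Cartan part along the Killing dual of `χ` and a central part from the
  -- cocycle, both proportional to the Killing form `κ` of the two vectors.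
  have hval : h = (κ • t χ.toLinear, fun i ↦ (m i : ℂ) * (formRatio b * κ), 0) := by
    refine cartanIncl_injective (b := b) (hh.trans ?_)
    rw [hxe, hye]
    ext1
    · simp [cartanIncl, Loop.single_lie, hmm, hbr, eulerSum_apply, loopEuler_single]
    · ext i
      simp [cartanIncl, cocycle_single, hmm, normalizedForm_apply, hκ]
    · simp [cartanIncl]
  let ℓ : Module.Dual ℂ H := lam ∘ₗ LinearMap.inl ℂ _ _
  have hcoroot (i : Index b) (hi : i ∈ A) : lam (simpleCoroot b i) = 0 :=
    hlam (Submodule.mem_sup_left (Submodule.subset_span ⟨i, hi, rfl⟩))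
  have hc2 : lam (central H 1) = 0 := hlam (Submodule.mem_sup_right (Submodule.mem_span_singleton_self _))
  have hlamh : lam h = κ * (ℓ (t χ.toLinear) + formRatio b * m 0 * lam (central H 0)) := by
    have e : h = κ • (LinearMap.inl ℂ H ((Fin 2 → ℂ) × (Fin 2 → ℂ)) (t χ.toLinear) +
        (formRatio b * m 0) • central H 0 + (formRatio b * m 1) • central H 1) := by
      rw [hval]
      refine Prod.ext (by simp [central]) (Prod.ext ?_ (by simp [central]))
      ext i
      fin_cases i <;> simp [central] <;> ring
    rw [e, map_smul, map_add, map_add, map_smul, map_smul, hc2]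
    simp [ℓ]
  obtain ⟨c, hc1, -, -, -, hc5⟩ := exists_int_coeff_weight b χ
  obtain ⟨c', n, hc1', hc2', -, -⟩ := exists_int_coeff
    (b := b) (β := β) ⟨hβ0, fun e ↦ hx0 (by rw [e] at hx; exact hx)⟩
  have hsome (i : b.support) : (c' (some i) : ℂ) = c i + m 0 * b.coeff (highestRoot b) i := by
    rw [← hc1', hχ]
    simp [affineCoweight, dualSimple, dualSimpleNegOne, hc1, mark_eq_coeff, mul_comm]
  have hnone : (c' none : ℂ) = m 0 := by
    rw [← hc1', hχ]
    simp [affineCoweight, dualSimple, hzero]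
  have hvan (i : Index b) (hi : i ∉ A) : (c' i : ℂ) = 0 := by
    rw [apply_fA hc1'] at hβ
    exact_mod_cast (sum_eq_zero_iff_of_sign hc2').mp (by exact_mod_cast hβ) i (by simpa using hi)
  have hθ : (rootSystem H).root (highestRoot b) =
      ∑ i, (b.coeff (highestRoot b) i : ℂ) • (rootSystem H).root i := by
    conv_lhs => rw [b.root_eq_sum_coeff]
    exact Finset.sum_congr rfl fun i _ ↦ (Int.cast_smul_eq_zsmul ℂ _ _).symm
  -- Since `c₁ = α₀^∨ + θ^∨`, and `λ(α₀^∨) = 0` or `m 0 = 0` according to whether `0 ∈ 𝒜`, the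
  -- central term becomes the value of `λ` on the dual of `m₁θ`.
  have hcen : formRatio b * m 0 * lam (central H 0) =
      m 0 * ℓ (t ((rootSystem H).root (highestRoot b))) := by
    have e : central H 0 = simpleCoroot b none +
        LinearMap.inl ℂ H ((Fin 2 → ℂ) × (Fin 2 → ℂ)) ((rootSystem H).coroot (highestRoot b)) := by
      simp [central, simpleCoroot]
    have e0 : (m 0 : ℂ) * lam (simpleCoroot b none) = 0 := by
      by_cases hA : none ∈ A
      · rw [hcoroot _ hA, mul_zero]
      · rw [← hnone, hvan _ hA, zero_mul]
    rw [ht, ← formRatio_smul_coroot, map_smul, e, map_add]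
    simp only [ℓ, LinearMap.comp_apply, smul_eq_mul]
    linear_combination formRatio b * e0
  have hsum : ℓ (t χ.toLinear) + m 0 * ℓ (t ((rootSystem H).root (highestRoot b))) =
      ∑ i, c' (some i) * ℓ (t ((rootSystem H).root i)) := by
    rw [hc5, hθ]
    simp only [map_sum, map_smul, smul_eq_mul, Finset.mul_sum, ← Finset.sum_add_distrib]
    refine Finset.sum_congr rfl fun i _ ↦ ?_
    rw [hsome]
    ring
  rw [hlamh, hcen, hsum]
  refine mul_eq_zero_of_right _ (Finset.sum_eq_zero fun i _ ↦ ?_)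
  -- What remains is a combination of duals of simple roots, each proportional to its coroot. For `i
  -- ∈ 𝒜` the functional kills it; for `i ∉ 𝒜` its coefficient is zero.
  by_cases hA : some i ∈ A
  · have h0 : ℓ ((rootSystem H).coroot i) = 0 := hcoroot _ hA
    rw [ht, cartanEquivDual_symm_root, map_smul, h0, smul_zero, mul_zero]
  · rw [hvan _ hA, zero_mul]

/-- The negative elements of `ℂ` for the lexicographic order. -/
def LexNeg (z : ℂ) : Prop := z.re < 0 ∨ z.re = 0 ∧ z.im < 0

lemma LexNeg.add {z w : ℂ} (hz : LexNeg z) (hw : LexNeg w) : LexNeg (z + w) := by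
  unfold LexNeg at *
  rw [Complex.add_re, Complex.add_im]
  rcases hz with h | ⟨h, h'⟩ <;> rcases hw with k | ⟨k, k'⟩
  · left; linarith
  · left; linarith
  · left; linarith
  · right; constructor <;> linarith

lemma not_lexNeg_add {z w : ℂ} (hz : ¬LexNeg z) (hw : ¬LexNeg w) : ¬LexNeg (z + w) := by
  unfold LexNeg at *
  push Not at *
  rw [Complex.add_re, Complex.add_im]
  refine ⟨by linarith [hz.1, hw.1], fun h ↦ ?_⟩
  have h1 : z.re = 0 := by linarith [hz.1, hw.1]
  have h2 : w.re = 0 := by linarith [hz.1, hw.1]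
  linarith [hz.2 h1, hw.2 h2]

lemma not_lexNeg_zero : ¬LexNeg 0 := by simp [LexNeg]

lemma eq_zero_of_not_lexNeg {z : ℂ} (hz : ¬LexNeg z) (hz' : ¬LexNeg (-z)) : z = 0 := by
  unfold LexNeg at *
  push Not at *
  rw [Complex.neg_re, Complex.neg_im] at hz'
  have h : z.re = 0 := by linarith [hz.1, hz'.1]
  refine Complex.ext h (le_antisymm ?_ (hz.2 h))
  have := hz'.2 (by linarith)
  simp only [Complex.zero_im]
  linarith

variable (b) in
/-- The sum of the root spaces `𝔗_β` with `β(f)` negative. -/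
def negAlg (f : Cartan H) : LieSubalgebra ℂ (𝔗 b) where
  toSubmodule := ⨆ β ∈ {β : Module.Dual ℂ (Cartan H) | LexNeg (β f)}, rootSpace b β
  lie_mem' := by
    intro x y hx hy
    change x ∈ ⨆ β ∈ {β : Module.Dual ℂ (Cartan H) | LexNeg (β f)}, rootSpace b β at hx
    change y ∈ ⨆ β ∈ {β : Module.Dual ℂ (Cartan H) | LexNeg (β f)}, rootSpace b β at hy
    change ⁅x, y⁆ ∈ ⨆ β ∈ {β : Module.Dual ℂ (Cartan H) | LexNeg (β f)}, rootSpace b β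
    rw [iSup_subtype'] at hx hy
    induction hx using Submodule.iSup_induction' with
    | zero => simp
    | add u v _ _ hu hv => rw [add_lie]; exact add_mem hu hv
    | mem α u hu =>
      induction hy using Submodule.iSup_induction' with
      | zero => simp
      | add v w _ _ hv hw => rw [lie_add]; exact add_mem hv hw
      | mem β v hv =>
        have hneg : LexNeg ((α.1 + β.1) f) := by
          rw [LinearMap.add_apply]
          exact LexNeg.add α.2 β.2
        exact Submodule.mem_iSup_of_mem (α.1 + β.1)
          (Submodule.mem_iSup_of_mem hneg (lie_mem_rootSpace hu hv))

lemma mem_negAlg {f : Cartan H} {β : Module.Dual ℂ (Cartan H)} (hβ : LexNeg (β f)) {x : 𝔗 b}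
    (hx : x ∈ rootSpace b β) : x ∈ negAlg b f :=
  (le_iSup₂_of_le β hβ le_rfl : rootSpace b β ≤
    ⨆ β ∈ {β : Module.Dual ℂ (Cartan H) | LexNeg (β f)}, rootSpace b β) hx

lemma negAlg_induction {f : Cartan H} {P : 𝔗 b → Prop} (zero : P 0)
    (add : ∀ x y, P x → P y → P (x + y))
    (mem : ∀ (β : Module.Dual ℂ (Cartan H)), LexNeg (β f) → ∀ x ∈ rootSpace b β, P x) {x : 𝔗 b}
    (hx : x ∈ negAlg b f) : P x := by
  change x ∈ ⨆ β ∈ {β : Module.Dual ℂ (Cartan H) | LexNeg (β f)}, rootSpace b β at hx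
  rw [iSup_subtype'] at hx
  induction hx using Submodule.iSup_induction' with
  | zero => exact zero
  | add x y _ _ hx hy => exact add x y hx hy
  | mem β x hx => exact mem β β.2 x hx

variable (b) in
/-- The sum of the root spaces `𝔗_β` with `β(f)` not negative. -/
def nonnegSpan (f : Cartan H) : Submodule ℂ (𝔗 b) :=
  ⨆ β : {β : Module.Dual ℂ (Cartan H) // ¬LexNeg (β f)}, rootSpace b β

lemma rootSpace_le_nonnegSpan {f : Cartan H} {β : Module.Dual ℂ (Cartan H)} (hβ : ¬LexNeg (β f)) :
    rootSpace b β ≤ nonnegSpan b f :=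
  le_iSup (fun γ : {γ : Module.Dual ℂ (Cartan H) // ¬LexNeg (γ f)} ↦ rootSpace b γ) ⟨β, hβ⟩

lemma negAlg_sup_nonnegSpan (f : Cartan H) :
    (negAlg b f).toSubmodule ⊔ nonnegSpan b f = ⊤ := by
  rw [eq_top_iff, ← iSup_rootSpace_eq_top b]
  refine iSup_le fun β ↦ ?_
  by_cases hβ : LexNeg (β f)
  · exact le_trans (fun x hx ↦ mem_negAlg hβ hx) le_sup_left
  · exact le_trans (rootSpace_le_nonnegSpan hβ) le_sup_right

end Triangular

end DoubleAffine

namespace DoubleAffine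

/-! ### Freeness and radicals of the modules induced from `𝔥̂` and a set of roots. -/

section InducedModules

open LieAlgebra LieAlgebra.IsKilling UniversalEnvelopingAlgebra

attribute [local instance 100] LieRing.ofAssociativeRing

variable {𝔤 : Type*} [LieRing 𝔤] [LieAlgebra ℂ 𝔤] [Module.Finite ℂ 𝔤] [LieAlgebra.IsSimple ℂ 𝔤]
variable {H : LieSubalgebra ℂ 𝔤} [H.IsCartanSubalgebra]
variable {b : (rootSystem H).Base}

/-- A linear map on `𝔗` may be prescribed on each root space. -/
lemma exists_linearMap_of_rootSpace {V : Type*} [AddCommGroup V] [Module ℂ V]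
    (φ : ∀ β, rootSpace b β →ₗ[ℂ] V) :
    ∃ F : 𝔗 b →ₗ[ℂ] V, ∀ β x (hx : x ∈ rootSpace b β), F x = φ β ⟨x, hx⟩ := by
  classical
  have hint := DirectSum.isInternal_submodule_of_iSupIndep_of_iSup_eq_top
    (iSupIndep_rootSpace b) (iSup_rootSpace_eq_top b)
  let e := LinearEquiv.ofBijective (DirectSum.coeLinearMap (rootSpace b)) hint
  refine ⟨DirectSum.toModule ℂ _ V φ ∘ₗ e.symm.toLinearMap, fun β x hx ↦ ?_⟩
  have h1 : e (DirectSum.lof ℂ _ (fun β ↦ rootSpace b β) β ⟨x, hx⟩) = x :=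
    DirectSum.coeLinearMap_lof (rootSpace b) β ⟨x, hx⟩
  have h2 : e.symm x = DirectSum.lof ℂ _ (fun β ↦ rootSpace b β) β ⟨x, hx⟩ := by
    rw [LinearEquiv.symm_apply_eq, h1]
  rw [LinearMap.comp_apply, LinearEquiv.coe_coe, h2, DirectSum.toModule_lof]

variable (b) in
-- `F` records how `𝔗` should act on the generator, and is the input for `exists_retraction`. It is
-- well defined because `𝔗` is the direct sum of its root spaces.
lemma exists_generatorMap (f : Cartan H) (lam : Module.Dual ℂ (Cartan H)) :
    ∃ F : 𝔗 b →ₗ[ℂ] UniversalEnvelopingAlgebra ℂ (negAlg b f),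
      (∀ a : negAlg b f, F a = ι ℂ a) ∧
      (∀ h, F (cartanIncl b h) = algebraMap ℂ _ (lam h)) ∧
      ∀ β : Module.Dual ℂ (Cartan H), β ≠ 0 → ¬LexNeg (β f) → ∀ x ∈ rootSpace b β, F x = 0 := by
  classical
  obtain ⟨r, hr⟩ := LinearMap.exists_leftInverse_of_injective (cartanIncl b)
    (LinearMap.ker_eq_bot.mpr cartanIncl_injective)
  obtain ⟨F, hF⟩ := exists_linearMap_of_rootSpace (b := b)
    (V := UniversalEnvelopingAlgebra ℂ (negAlg b f)) fun β ↦
      if hβ : LexNeg (β f) then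
        (ι ℂ : negAlg b f →ₗ⁅ℂ⁆ _).toLinearMap ∘ₗ
          Submodule.inclusion (p' := (negAlg b f).toSubmodule) (fun _ hx ↦ mem_negAlg hβ hx)
      else if β = 0 then Algebra.linearMap ℂ _ ∘ₗ lam ∘ₗ r ∘ₗ Submodule.subtype _
      else 0
  refine ⟨F, fun a ↦ ?_, fun h ↦ ?_, fun β hβ0 hβ x hx ↦ ?_⟩
  · suffices ∃ h : (a : 𝔗 b) ∈ negAlg b f, F a = ι ℂ ⟨a, h⟩ from this.2
    refine negAlg_induction (P := fun x ↦ ∃ h : x ∈ negAlg b f, F x = ι ℂ ⟨x, h⟩) ?_ ?_ ?_ a.2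
    · refine ⟨zero_mem _, ?_⟩
      rw [map_zero]
      exact (map_zero (ι ℂ)).symm
    · rintro x y ⟨hx, hx'⟩ ⟨hy, hy'⟩
      refine ⟨add_mem hx hy, ?_⟩
      rw [map_add, hx', hy', ← map_add]
      rfl
    · intro β hβ x hx
      refine ⟨mem_negAlg hβ hx, ?_⟩
      rw [hF β x hx, dif_pos hβ]
      rfl
  · have h0 : cartanIncl b h ∈ rootSpace b 0 := fun k ↦ by
      rw [lie_cartanIncl, LinearMap.zero_apply, zero_smul]
    rw [hF 0 _ h0, dif_neg (by simpa using not_lexNeg_zero), if_pos rfl]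
    have := LinearMap.congr_fun hr h
    simp only [LinearMap.comp_apply, LinearMap.id_apply] at this
    simp [this]
  · rw [hF β x hx, dif_neg hβ, if_neg hβ0]
    rfl

lemma nonnegSpan_induction {f : Cartan H} {P : 𝔗 b → Prop} (zero : P 0)
    (add : ∀ x y, P x → P y → P (x + y))
    (mem : ∀ (β : Module.Dual ℂ (Cartan H)), ¬LexNeg (β f) → ∀ x ∈ rootSpace b β, P x) {x : 𝔗 b}
    (hx : x ∈ nonnegSpan b f) : P x := by
  rw [nonnegSpan] at hx
  induction hx using Submodule.iSup_induction' with
  | zero => exact zero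
  | add x y _ _ hx hy => exact add x y hx hy
  | mem β x hx => exact mem β β.2 x hx

/-- If `λ` defines a one-dimensional representation of the sum of the root spaces `𝔗_β` with `β(f)`
not negative, then there is a retraction of `U(𝔗₋) → U(𝔗)`, with `𝔗₋` the sum of the root spaces with
`β(f)` negative, which kills the annihilator of the generator of the induced module. -/
theorem exists_retraction_inducingIdeal {f : Cartan H} {lam : Module.Dual ℂ (Cartan H)}
    {S : Set (Module.Dual ℂ (Cartan H))} (hS : ∀ β ∈ S, β ≠ 0 ∧ ¬LexNeg (β f))
    (hlam : ∀ β : Module.Dual ℂ (Cartan H), β f = 0 → ∀ x ∈ rootSpace b β,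
      ∀ y ∈ rootSpace b (-β), ∀ h, cartanIncl b h = ⁅x, y⁆ → lam h = 0) :
    ∃ ψ : U𝔗 b →ₗ[ℂ] UniversalEnvelopingAlgebra ℂ (negAlg b f),
      (∀ u, ψ (inclMap (negAlg b f) u) = u) ∧ ∀ z ∈ inducingIdeal b S lam, ψ z = 0 := by
  obtain ⟨F, hF1, hF2, hF3⟩ := exists_generatorMap b f lam
  have hscal : ∀ x ∈ nonnegSpan b f, ∃ c, F x = algebraMap ℂ _ c := fun x hx ↦ by
    refine nonnegSpan_induction (P := fun x ↦ ∃ c, F x = algebraMap ℂ _ c) ⟨0, by simp⟩ ?_ ?_ hx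
    · rintro x y ⟨c, hc⟩ ⟨d, hd⟩
      exact ⟨c + d, by rw [map_add, map_add, hc, hd]⟩
    · intro β hβ x hx
      by_cases h0 : β = 0
      · subst h0
        obtain ⟨h, rfl⟩ := exists_cartanIncl_eq hx
        exact ⟨_, hF2 h⟩
      · exact ⟨0, by rw [hF3 β h0 hβ x hx, map_zero]⟩
  -- A bracket of weight other than zero lies in a root space killed by `F`. For opposite weights,
  -- neither negative at `f`, the weight vanishes at `f`, and `hlam` applies.
  have hlie : ∀ x ∈ nonnegSpan b f, ∀ y ∈ nonnegSpan b f, F ⁅x, y⁆ = 0 := fun x hx y hy ↦ by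
    refine nonnegSpan_induction (P := fun x ↦ F ⁅x, y⁆ = 0) (by simp) ?_ ?_ hx
    · intro x x' h h'
      rw [add_lie, map_add, h, h', add_zero]
    intro α hα x hx
    refine nonnegSpan_induction (P := fun y ↦ F ⁅x, y⁆ = 0) (by simp) ?_ ?_ hy
    · intro x x' h h'
      rw [lie_add, map_add, h, h', add_zero]
    intro β hβ y hy
    have hmem := lie_mem_rootSpace hx hy
    by_cases h0 : α + β = 0
    · obtain rfl : β = -α := eq_neg_of_add_eq_zero_right h0
      rw [h0] at hmem
      obtain ⟨h, hh⟩ := exists_cartanIncl_eq hmem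
      rw [LinearMap.neg_apply] at hβ
      rw [← hh, hF2, hlam α (eq_zero_of_not_lexNeg hα hβ) x hx y hy h hh, map_zero]
    · refine hF3 _ h0 ?_ _ hmem
      rw [LinearMap.add_apply]
      exact not_lexNeg_add hα hβ
  obtain ⟨ψ, hψ1, hψ2⟩ := exists_retraction hF1 (nonnegSpan b f) (negAlg_sup_nonnegSpan f) hscal hlie
  refine ⟨ψ, hψ1, fun z hz ↦ ?_⟩
  -- `ψ` is only `ℂ`-linear, so the claim is strengthened to all left multiples to pass through the
  -- span over `U(𝔗)`.
  suffices ∀ w, ψ (w * z) = 0 by simpa using this 1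
  rw [inducingIdeal] at hz
  induction hz using Submodule.span_induction with
  | zero => simp
  | add x y _ _ hx hy => intro w; rw [mul_add, map_add, hx, hy, add_zero]
  | smul a x _ hx => intro w; rw [smul_eq_mul, ← mul_assoc, hx]
  | mem x hx =>
    intro w
    rcases hx with ⟨β, hβ, x, hx, rfl⟩ | ⟨h, rfl⟩
    · rw [hψ2 w x 0 (by rw [hF3 β (hS β hβ).1 (hS β hβ).2 x hx, map_zero]), map_zero, mul_zero,
        map_zero]
    · rw [mul_sub, map_sub, hψ2 w _ _ (hF2 h), sub_self]

variable {S : Set (Module.Dual ℂ (Cartan H))} {f : Cartan H} {lam : Module.Dual ℂ (Cartan H)}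

variable (b S lam) in
/-- The generator of an induced module. -/
def Induced.gen : Induced b S lam := Submodule.Quotient.mk 1

lemma Induced.smul_gen (u : U𝔗 b) : u • Induced.gen b S lam = Submodule.Quotient.mk u := by
  rw [Induced.gen, ← Submodule.Quotient.mk_smul, smul_eq_mul, mul_one]

lemma Induced.exists_smul_gen (m : Induced b S lam) : ∃ u : U𝔗 b, u • Induced.gen b S lam = m := by
  obtain ⟨u, rfl⟩ := Submodule.Quotient.mk_surjective _ m
  exact ⟨u, Induced.smul_gen u⟩

lemma Induced.cartan_smul_gen (h : Cartan H) : ι ℂ (cartanIncl b h) • Induced.gen b S lam =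
    algebraMap ℂ (U𝔗 b) (lam h) • Induced.gen b S lam := by
  rw [Induced.smul_gen, Induced.smul_gen, Submodule.Quotient.eq]
  exact Submodule.subset_span (Or.inr ⟨h, rfl⟩)

lemma Induced.root_smul_gen {β : Module.Dual ℂ (Cartan H)} (hβ : β ∈ S) {x : 𝔗 b}
    (hx : x ∈ rootSpace b β) : ι ℂ x • Induced.gen b S lam = 0 := by
  rw [Induced.smul_gen, Submodule.Quotient.mk_eq_zero]
  exact Submodule.subset_span (Or.inl ⟨β, hβ, x, hx, rfl⟩)

lemma Induced.injective_smul_gen (hS : ∀ β ∈ S, β ≠ 0 ∧ ¬LexNeg (β f))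
    (hlam : ∀ β : Module.Dual ℂ (Cartan H), β f = 0 → ∀ x ∈ rootSpace b β,
      ∀ y ∈ rootSpace b (-β), ∀ h, cartanIncl b h = ⁅x, y⁆ → lam h = 0) :
    Function.Injective fun u ↦ inclMap (negAlg b f) u • Induced.gen b S lam := by
  obtain ⟨ψ, h1, h2⟩ := exists_retraction_inducingIdeal hS hlam
  intro u v huv
  simp only [Induced.smul_gen, Submodule.Quotient.eq] at huv
  have := h2 _ huv
  rwa [map_sub, h1, h1, sub_eq_zero] at this

/-- A universal enveloping algebra is not zero. -/
lemma nontrivial_universalEnvelopingAlgebra (L : Type*) [LieRing L] [LieAlgebra ℂ L] :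
    Nontrivial (UniversalEnvelopingAlgebra ℂ L) :=
  (lift ℂ (0 : L →ₗ⁅ℂ⁆ ℂ)).toRingHom.domain_nontrivial

lemma Induced.nontrivial (hS : ∀ β ∈ S, β ≠ 0 ∧ ¬LexNeg (β f))
    (hlam : ∀ β : Module.Dual ℂ (Cartan H), β f = 0 → ∀ x ∈ rootSpace b β,
      ∀ y ∈ rootSpace b (-β), ∀ h, cartanIncl b h = ⁅x, y⁆ → lam h = 0) :
    Nontrivial (Induced b S lam) :=
  have := nontrivial_universalEnvelopingAlgebra (negAlg b f)
  (Induced.injective_smul_gen hS hlam).nontrivial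

lemma Induced.exists_inclMap_smul_gen (hS : ∀ β ∈ roots b, ¬LexNeg (β f) → β ∈ S)
    (m : Induced b S lam) : ∃ u, inclMap (negAlg b f) u • Induced.gen b S lam = m := by
  obtain ⟨w, rfl⟩ := Induced.exists_smul_gen m
  have key (x : 𝔗 b) (hx : x ∈ nonnegSpan b f) : ∃ c : ℂ, ι ℂ x • Induced.gen b S lam =
      algebraMap ℂ (U𝔗 b) c • Induced.gen b S lam := by
    refine nonnegSpan_induction (P := fun x ↦ ∃ c : ℂ, ι ℂ x • Induced.gen b S lam =
      algebraMap ℂ (U𝔗 b) c • Induced.gen b S lam) ⟨0, ?_⟩ ?_ ?_ hx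
    · rw [map_zero, map_zero, zero_smul]
    · rintro x y ⟨c, hc⟩ ⟨d, hd⟩
      exact ⟨c + d, by rw [map_add, map_add, add_smul, add_smul, hc, hd]⟩
    · intro β hβ x hx
      by_cases h0 : β = 0
      · subst h0
        obtain ⟨h, rfl⟩ := exists_cartanIncl_eq hx
        exact ⟨_, Induced.cartan_smul_gen h⟩
      · refine ⟨0, ?_⟩
        rw [map_zero, zero_smul]
        by_cases hx0 : x = 0
        · rw [hx0, map_zero, zero_smul]
        · exact Induced.root_smul_gen (hS β ⟨h0, fun e ↦ hx0 (by simpa [e] using hx)⟩ hβ) hx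
  obtain ⟨u, hu⟩ := exists_inclMap_smul_eq (negAlg b f) (nonnegSpan b f) (negAlg_sup_nonnegSpan f)
    (v := Induced.gen b S lam) key w
  exact ⟨u, hu.symm⟩

/-- The sum of the proper submodules of a nonzero induced module is proper. -/
theorem Induced.radical_ne_top (hS : ∀ β ∈ roots b, ¬LexNeg (β f) → β ∈ S)
    [Nontrivial (Induced b S lam)] : radical (U𝔗 b) (Induced b S lam) ≠ ⊤ := by
  set v := Induced.gen b S lam with hv
  let E (ν : ℂ) : Submodule ℂ (Induced b S lam) :=
    Module.End.eigenspace (Algebra.lsmul ℂ ℂ (Induced b S lam) (ι ℂ (cartanIncl b f))) ν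
  have memE (ν : ℂ) (m : Induced b S lam) : m ∈ E ν ↔ ι ℂ (cartanIncl b f) • m = ν • m :=
    Module.End.mem_eigenspace_iff
  have hvE : v ∈ E (lam f) := by
    rw [memE, hv, Induced.cartan_smul_gen, algebraMap_smul]
  have hact {β : Module.Dual ℂ (Cartan H)} {x : 𝔗 b} (hx : x ∈ rootSpace b β) {ν : ℂ}
      {m : Induced b S lam} (hm : m ∈ E ν) : ι ℂ x • m ∈ E (ν + β f) := by
    rw [memE] at hm ⊢
    have e : ι ℂ (cartanIncl b f) * ι ℂ x = ι ℂ x * ι ℂ (cartanIncl b f) + β f • ι ℂ x := by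
      rw [← map_smul, ← hx f, LieHom.map_lie, LieRing.of_associative_ring_bracket]
      abel
    rw [← mul_smul, e, add_smul, mul_smul, hm, smul_assoc, smul_algebra_smul_comm, ← add_smul]
  have hv0 : v ≠ 0 := by
    intro h0
    obtain ⟨m, hm⟩ := exists_ne (0 : Induced b S lam)
    obtain ⟨u, rfl⟩ := Induced.exists_smul_gen m
    exact hm (by rw [← hv, h0, smul_zero])
  -- Each factor from `negAlg b f` lowers the eigenvalue of `f` strictly in the lexicographic order,
  -- so only the constant term of `u` contributes to the eigenvalue of `v`.
  have key (u : UniversalEnvelopingAlgebra ℂ (negAlg b f)) :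
      ∃ c : ℂ, inclMap (negAlg b f) u • v - c • v ∈ ⨆ ν ∈ {ν : ℂ | LexNeg (ν - lam f)}, E ν := by
    induction u using induction_left with
    | one => exact ⟨1, by simp⟩
    | add u w hu hw =>
      obtain ⟨c, hc⟩ := hu
      obtain ⟨d, hd⟩ := hw
      refine ⟨c + d, ?_⟩
      rw [map_add, add_smul, add_smul, add_sub_add_comm]
      exact add_mem hc hd
    | smul r u hu =>
      obtain ⟨c, hc⟩ := hu
      refine ⟨r * c, ?_⟩
      rw [map_smul, smul_assoc, mul_smul, ← smul_sub]
      exact Submodule.smul_mem _ r hc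
    | ι_mul a u hu =>
      obtain ⟨c, hc⟩ := hu
      refine ⟨0, ?_⟩
      rw [zero_smul, sub_zero, map_mul, inclMap_ι, mul_smul]
      refine negAlg_induction (P := fun x ↦ ι ℂ x • inclMap (negAlg b f) u • v ∈
        ⨆ ν ∈ {ν : ℂ | LexNeg (ν - lam f)}, E ν) ?_ ?_ ?_ a.2
      · rw [map_zero, zero_smul]
        exact zero_mem _
      · intro x y hx hy
        rw [map_add, add_smul]
        exact add_mem hx hy
      intro β hβ x hx
      have e : inclMap (negAlg b f) u • v = c • v + (inclMap (negAlg b f) u • v - c • v) := by abel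
      rw [e, smul_add]
      refine add_mem ?_ ?_
      · have h1 : LexNeg (lam f + β f - lam f) := by rwa [add_sub_cancel_left]
        exact Submodule.mem_iSup_of_mem _ (Submodule.mem_iSup_of_mem h1
          (hact hx (Submodule.smul_mem _ c hvE)))
      · generalize inclMap (negAlg b f) u • v - c • v = m at hc
        rw [iSup_subtype'] at hc
        induction hc using Submodule.iSup_induction' with
        | zero => rw [smul_zero]; exact zero_mem _
        | add m m' _ _ hm hm' => rw [smul_add]; exact add_mem hm hm'
        | mem ν m hm =>
          have h1 : LexNeg (ν + β f - lam f) := by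
            rw [add_sub_right_comm]
            exact LexNeg.add ν.2 hβ
          exact Submodule.mem_iSup_of_mem _ (Submodule.mem_iSup_of_mem h1 (hact hx hm))
  refine radical_ne_top_of_eigenspaces hv0 Induced.exists_smul_gen hvE fun m ↦ ?_
  obtain ⟨u, rfl⟩ := Induced.exists_inclMap_smul_gen hS m
  obtain ⟨c, hc⟩ := key u
  refine ⟨c, ?_⟩
  refine (biSup_mono fun ν hν ↦ ?_ : (⨆ ν ∈ {ν : ℂ | LexNeg (ν - lam f)}, E ν) ≤ _) hc
  rintro rfl
  have hν' : LexNeg (lam f - lam f) := hν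
  rw [sub_self] at hν'
  exact not_lexNeg_zero hν'

/-- Induced modules for larger subalgebras are quotients. -/
lemma Induced.exists_surjective {S' : Set (Module.Dual ℂ (Cartan H))} (h : S ⊆ S') :
    ∃ g : Induced b S lam →ₗ[U𝔗 b] Induced b S' lam, Function.Surjective g := by
  have hle : inducingIdeal b S lam ≤ inducingIdeal b S' lam :=
    Submodule.span_mono (Set.union_subset_union_left _
      fun u ⟨β, hβ, x, hx, hu⟩ ↦ ⟨β, h hβ, x, hx, hu⟩)
  exact ⟨Submodule.factor hle, Submodule.factor_surjective hle⟩

end InducedModules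

end DoubleAffine

namespace DoubleAffine

/-! ### The three families of modules and homomorphisms between Verma modules. -/

section VermaModules

open LieAlgebra LieAlgebra.IsKilling UniversalEnvelopingAlgebra

attribute [local instance 100] LieRing.ofAssociativeRing

variable {𝔤 : Type*} [LieRing 𝔤] [LieAlgebra ℂ 𝔤] [Module.Finite ℂ 𝔤] [LieAlgebra.IsSimple ℂ 𝔤]
variable {H : LieSubalgebra ℂ 𝔤} [H.IsCartanSubalgebra]
variable {b : (rootSystem H).Base}

lemma not_lexNeg_intCast {n : ℤ} : ¬LexNeg (n : ℂ) ↔ 0 ≤ n := by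
  simp [LexNeg]

lemma mem_phiPos {β : Module.Dual ℂ (Cartan H)} :
    β ∈ phiPos b ↔ β ∈ roots b ∧ 0 < (β (phi b)).re := by
  refine ⟨phi_pos_of_mem b, fun h ↦ ⟨Or.inl h, ?_⟩⟩
  rintro ⟨n, -, rfl⟩
  have h2 := h.2
  rw [LinearMap.smul_apply, delta_phi] at h2
  simp at h2

/-- The subalgebra `𝔗₋` consists of the root spaces on which `φ` is negative. -/
lemma tNeg_eq_negAlg : tNeg b = negAlg b (phi b) := by
  rw [← LieSubalgebra.toSubmodule_inj]
  change (⨆ β ∈ phiNeg b, rootSpace b β) = ⨆ β ∈ {β | LexNeg (β (phi b))}, rootSpace b β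
  refine le_antisymm (iSup₂_le fun β hβ ↦ ?_) (iSup₂_le fun β hβ ↦ ?_)
  · refine le_iSup₂_of_le β (Or.inl ?_) le_rfl
    have := (mem_phiPos.mp hβ).2
    rw [LinearMap.neg_apply, Complex.neg_re] at this
    linarith
  -- `negAlg` ranges over all functionals, those which are not roots contributing zero. On roots `φ`
  -- takes integral values, so the imaginary alternative of `LexNeg` is void.
  · by_cases hbot : rootSpace b β = ⊥
    · rw [hbot]
      exact bot_le
    have hroot : β ∈ roots b := by
      refine ⟨fun e ↦ not_lexNeg_zero ?_, hbot⟩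
      simpa [e] using hβ
    refine le_iSup₂_of_le β (mem_phiPos.mpr ⟨neg_mem_roots hroot, ?_⟩) le_rfl
    obtain ⟨c, n, hc, -⟩ := exists_int_coeff hroot
    rw [LinearMap.neg_apply, Complex.neg_re]
    rw [Set.mem_ofPred_eq, apply_phi hc] at hβ
    rw [apply_phi hc]
    simpa only [LexNeg, Complex.intCast_re, Complex.intCast_im, lt_irrefl, and_false, or_false,
      Left.neg_pos_iff] using hβ

/-- A root which is not negative on `φ + √-1 α₋₁^*` lies in `ℐ`. -/
lemma mem_setI {β : Module.Dual ℂ (Cartan H)} (hβ : β ∈ roots b)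
    (h : ¬LexNeg (β (phi b + Complex.I • dualSimpleNegOne H))) : β ∈ setI b := by
  obtain ⟨c, n, hc, hsign, hn, h0⟩ := exists_int_coeff hβ
  rw [map_add, map_smul, hn, apply_phi hc] at h
  -- The real part is `β(φ)` and the imaginary part is the coefficient of `δ₂`, so `h` says that
  -- `β(φ) > 0`, or `β(φ) = 0` and `n ≥ 0`.
  simp only [LexNeg, smul_eq_mul, Complex.add_re, Complex.add_im, Complex.intCast_re,
    Complex.intCast_im, Complex.mul_re, Complex.mul_im, Complex.I_re, Complex.I_im, zero_mul,
    mul_zero, sub_zero, add_zero, zero_add, one_mul, not_or, not_and, not_lt] at h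
  rcases lt_or_eq_of_le h.1 with hpos | hzero
  · refine Or.inl ⟨hβ, ?_⟩
    rwa [apply_phi hc, Complex.intCast_re]
  · have hc0 : c = 0 := by
      funext i
      exact (sum_eq_zero_iff_of_sign hsign).mp (by exact_mod_cast hzero.symm) i (Finset.mem_univ i)
    have hn0 : 0 ≤ n := by exact_mod_cast h.2 hzero.symm
    lift n to ℕ using hn0
    refine Or.inr ⟨n, Nat.pos_of_ne_zero fun e ↦ hβ.1 ?_, ?_⟩
    · rw [h0 hc0, e]
      simp
    · rw [h0 hc0, natCast_zsmul]

lemma mem_phiPos_union {β : Module.Dual ℂ (Cartan H)} (hβ : β ∈ roots b)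
    (h : ¬LexNeg (β (phi b))) : β ∈ phiPos b ∪ (phiZero H \ {0}) := by
  obtain ⟨c, n, hc, hsign, -, h0⟩ := exists_int_coeff hβ
  rw [apply_phi hc, not_lexNeg_intCast] at h
  rcases h.lt_or_eq with hpos | hzero
  · refine Or.inl (mem_phiPos.mpr ⟨hβ, ?_⟩)
    rw [apply_phi hc, Complex.intCast_re]
    exact_mod_cast hpos
  · refine Or.inr ⟨⟨n, h0 ?_⟩, hβ.1⟩
    funext i
    exact (sum_eq_zero_iff_of_sign hsign).mp hzero.symm i (Finset.mem_univ i)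

lemma ne_zero_and_not_lexNeg_of_mem_setQ {A : Finset (Index b)} {β : Module.Dual ℂ (Cartan H)}
    (hβ : β ∈ setQ b A) : β ≠ 0 ∧ ¬LexNeg (β (fA b A)) := by
  classical
  obtain ⟨c, n, hc, -⟩ := exists_int_coeff hβ.1
  refine ⟨hβ.1.1, ?_⟩
  have h := hβ.2
  rw [apply_fA hc, not_lexNeg_intCast]
  rw [apply_fA hc, Complex.intCast_re] at h
  exact_mod_cast h

lemma ne_zero_and_not_lexNeg_of_mem_phiPos_union {β : Module.Dual ℂ (Cartan H)}
    (hβ : β ∈ phiPos b ∪ (phiZero H \ {0})) : β ≠ 0 ∧ ¬LexNeg (β (phi b)) := by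
  rw [phi_eq_fA]
  exact ne_zero_and_not_lexNeg_of_mem_setQ (phiPos_union_subset ∅ hβ)

lemma apply_eq_zero_of_lie_phi {lam : Module.Dual ℂ (Cartan H)} (hlam : lam (central H 1) = 0)
    (β : Module.Dual ℂ (Cartan H)) (hβ : β (phi b) = 0) :
    ∀ x ∈ rootSpace b β, ∀ y ∈ rootSpace b (-β), ∀ h, cartanIncl b h = ⁅x, y⁆ → lam h = 0 := by
  intro x hx y hy h hh
  rw [phi_eq_fA] at hβ
  refine apply_eq_zero_of_lie ?_ hβ hx hy hh
  simpa [cartanA, Submodule.span_le] using hlam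

/-- The universal enveloping algebra of a sum of negative root spaces is a domain. -/
lemma eq_zero_or_eq_zero_of_mul_eq_zero {f : Cartan H}
    {u v : UniversalEnvelopingAlgebra ℂ (negAlg b f)} (huv : u * v = 0) : u = 0 ∨ v = 0 := by
  -- The adjoint action on all of `𝔗` is faithful on the negative part: an element commuting with
  -- `𝔥̂` has weight zero, while negative elements have no component of weight zero.
  refine eq_zero_or_eq_zero_of_faithful (𝔗 b) (fun x hx ↦ ?_) huv
  have h0 : (x : 𝔗 b) ∈ rootSpace b 0 := fun h ↦ by
    rw [LinearMap.zero_apply, zero_smul, ← lie_skew, neg_eq_zero]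
    exact hx (cartanIncl b h)
  have h1 : (x : 𝔗 b) ∈ ⨆ β ≠ 0, rootSpace b β := by
    refine (biSup_mono fun β hβ ↦ ?_ :
      (⨆ β ∈ {β : Module.Dual ℂ (Cartan H) | LexNeg (β f)}, rootSpace b β) ≤ _) x.2
    rintro rfl
    exact not_lexNeg_zero hβ
  exact Subtype.ext ((Submodule.disjoint_def.mp (iSupIndep_rootSpace b 0)) _ h0 h1)

/-- `M(λ)` is free over `U(𝔗₋)`. -/
lemma bijective_smul_gen {lam : Module.Dual ℂ (Cartan H)} (hlam : lam (central H 1) = 0)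
    {𝔞 : LieSubalgebra ℂ (𝔗 b)} (h𝔞 : 𝔞 = negAlg b (phi b)) :
    Function.Bijective fun u ↦ inclMap 𝔞 u • Verma.gen b lam := by
  subst h𝔞
  exact ⟨Induced.injective_smul_gen (fun β ↦ ne_zero_and_not_lexNeg_of_mem_phiPos_union)
    (apply_eq_zero_of_lie_phi hlam), Induced.exists_inclMap_smul_gen fun β ↦ mem_phiPos_union⟩

lemma nontrivial_verma {lam : Module.Dual ℂ (Cartan H)} (hlam : lam (central H 1) = 0) :
    Nontrivial (Verma b lam) :=
  Induced.nontrivial (fun _ ↦ ne_zero_and_not_lexNeg_of_mem_phiPos_union)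
    (apply_eq_zero_of_lie_phi hlam)

lemma nontrivial_generalizedVerma {A : Finset (Index b)} {lam : Module.Dual ℂ (Cartan H)}
    (hlam : cartanA b A ≤ LinearMap.ker lam) : Nontrivial (GeneralizedVerma b A lam) :=
  Induced.nontrivial (fun _ ↦ ne_zero_and_not_lexNeg_of_mem_setQ)
    fun _ hβ _ hx _ hy _ hh ↦ apply_eq_zero_of_lie hlam hβ hx hy hh

/-- The module is nonzero because it maps onto `M(λ)`. The eigenvalue of `φ + √-1 α₋₁^*` also
separates the generator from the vectors produced by negative multiples of `δ₂`, which `φ` alone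
does not see. -/
lemma radical_imaginaryVerma_ne_top {lam : Module.Dual ℂ (Cartan H)}
    (hlam : lam (central H 1) = 0) : radical (U𝔗 b) (ImaginaryVerma b lam) ≠ ⊤ := by
  obtain ⟨g, hg⟩ := Induced.exists_surjective (lam := lam) (setI_subset (b := b))
  have := nontrivial_verma (b := b) hlam
  have : Nontrivial (ImaginaryVerma b lam) := hg.nontrivial
  exact Induced.radical_ne_top fun β ↦ mem_setI

/-- A nonzero homomorphism between the modules `M(λ)` and `M(μ)` is injective. -/
lemma injective_of_ne_zero {lam mu : Module.Dual ℂ (Cartan H)} (hlam : lam (central H 1) = 0)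
    (hmu : mu (central H 1) = 0) {f : Verma b lam →ₗ[U𝔗 b] Verma b mu} (hf : f ≠ 0) :
    Function.Injective f := by
  have hl := bijective_smul_gen (b := b) hlam rfl
  have hm := bijective_smul_gen (b := b) hmu rfl
  -- By freeness the homomorphism becomes right multiplication by `w` on the enveloping algebra of
  -- the negative part, where nonzero `w` can be cancelled.
  obtain ⟨w, hw⟩ := hm.2 (f (Verma.gen b lam))
  have hval (u : UniversalEnvelopingAlgebra ℂ (negAlg b (phi b))) :
      f (inclMap _ u • Verma.gen b lam) = inclMap _ (u * w) • Verma.gen b mu := by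
    rw [map_smul, ← hw, map_mul, mul_smul]
  have hw0 : w ≠ 0 := by
    rintro rfl
    refine hf (LinearMap.ext fun m ↦ ?_)
    obtain ⟨u, rfl⟩ := hl.2 m
    rw [hval, mul_zero, map_zero, zero_smul, LinearMap.zero_apply]
  refine (injective_iff_map_eq_zero f).mpr fun m hm0 ↦ ?_
  obtain ⟨u, rfl⟩ := hl.2 m
  rw [hval] at hm0
  have huw : u * w = 0 := hm.1 (by simpa using hm0)
  rw [(eq_zero_or_eq_zero_of_mul_eq_zero huw).resolve_right hw0]
  simp

end VermaModules

end DoubleAffine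

end

/-! ### The five assertions together. -/

open DoubleAffine in
theorem mainTheorem11 {𝔤 : Type*} [LieRing 𝔤] [LieAlgebra ℂ 𝔤] [Module.Finite ℂ 𝔤]
    [LieAlgebra.IsSimple ℂ 𝔤] (H : LieSubalgebra ℂ 𝔤) [H.IsCartanSubalgebra]
    (b : (LieAlgebra.IsKilling.rootSystem H).Base) (hb : b.cartanMatrix.IsSimplyLaced)
    (lam : Module.Dual ℂ (Cartan H)) (hlam : lam (central H 1) = 0) :
    -- `M(λ)` is a free `U(𝔗₋)`-module with basis `v_λ`
    (Function.Bijective fun u : UniversalEnvelopingAlgebra ℂ (tNeg b) ↦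
      tNegMap b u • Verma.gen b lam) ∧
    -- `M(λ)` has a unique irreducible quotient
    HasUniqueIrreducibleQuotient (U𝔗 b) (Verma b lam) ∧
    -- the chain of surjections
    (∀ A A'' : Finset (Index b), cartanA b A ≤ LinearMap.ker lam → A'' ⊆ A →
      ∃ (f : ImaginaryVerma b lam →ₗ[U𝔗 b] Verma b lam)
        (g : Verma b lam →ₗ[U𝔗 b] GeneralizedVerma b A'' lam)
        (h : GeneralizedVerma b A'' lam →ₗ[U𝔗 b] GeneralizedVerma b A lam),
        Function.Surjective f ∧ Function.Surjective g ∧ Function.Surjective h) ∧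
    -- nonzero homomorphisms are injective
    (∀ mu : Module.Dual ℂ (Cartan H), mu (central H 1) = 0 →
      ∀ f : Verma b lam →ₗ[U𝔗 b] Verma b mu, f ≠ 0 → Function.Injective f) ∧
    -- the irreducible quotients agree when `𝒜` is maximal
    (∀ A : Finset (Index b), cartanA b A ≤ LinearMap.ker lam →
      (∀ A' : Finset (Index b), A ⊂ A' → ∀ i ∈ A', i ∉ A → lam (simpleCoroot b i) ≠ 0) →
      HasUniqueIrreducibleQuotient (U𝔗 b) (ImaginaryVerma b lam) ∧
      HasUniqueIrreducibleQuotient (U𝔗 b) (GeneralizedVerma b A lam) ∧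
      Nonempty (IrreducibleQuotient (U𝔗 b) (ImaginaryVerma b lam) ≃ₗ[U𝔗 b]
        IrreducibleQuotient (U𝔗 b) (Verma b lam)) ∧
      Nonempty (IrreducibleQuotient (U𝔗 b) (Verma b lam) ≃ₗ[U𝔗 b]
        IrreducibleQuotient (U𝔗 b) (GeneralizedVerma b A lam))) := by
  have hI := radical_imaginaryVerma_ne_top (b := b) hlam
  have hV := nontrivial_verma (b := b) hlam
  obtain ⟨p, hp⟩ := Induced.exists_surjective (lam := lam) (setI_subset (b := b))
  -- The radical of the imaginary Verma module is the only one bounded directly; the others follow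
  -- along the surjections.
  have hM := radical_ne_top_of_surjective hI hp
  -- `tNegMap b` is by definition `inclMap (tNeg b)`, so freeness over `negAlg b (phi b)` transfers
  -- along the equality of the two subalgebras.
  refine ⟨bijective_smul_gen hlam tNeg_eq_negAlg, hasUniqueIrreducibleQuotient_of_radical_ne_top hM,
    fun A A'' _ hA ↦ ?_, fun mu hmu f hf ↦ injective_of_ne_zero hlam hmu hf, fun A hA _ ↦ ?_⟩
  · obtain ⟨g, hg⟩ := Induced.exists_surjective (lam := lam) (phiPos_union_subset A'')
    obtain ⟨h, hh⟩ := Induced.exists_surjective (lam := lam) (setQ_mono hA)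
    exact ⟨p, g, h, hp, hg, hh⟩
  · have := nontrivial_generalizedVerma hA
    obtain ⟨g, hg⟩ := Induced.exists_surjective (lam := lam) (phiPos_union_subset A)
    exact ⟨hasUniqueIrreducibleQuotient_of_radical_ne_top hI,
      hasUniqueIrreducibleQuotient_of_radical_ne_top (radical_ne_top_of_surjective hM hg),
      nonempty_irreducibleQuotient_equiv hI hp, nonempty_irreducibleQuotient_equiv hM hg⟩
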